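/- Let $\mathbb{F}$ be a field of arbitrary characteristic. For integers $n,d\ge 1$ and $k,e\ge 0$, let $\mathcal{SDC}\subseteq\mathbb{F}[x_1,\dots,x_n]$ be the set of polynomials computable by semi-diagonal depth-4 circuits, that is, of the form $$\Phi=\sum_{i=1}^{k} m_i(\vec{x})\cdot P_{i,1}^{e_{i,1}}\cdots P_{i,r_i}^{e_{i,r_i}},$$ where each $m_i$ is a monomial (possibly with a scalar coefficient) of degree $\le d$, the number $r_i$ of factors is arbitrary, $\prod_{j=1}^{r_i}(1+e_{i,j})\le e$, and each $P_{i,j}=\sum_{m=1}^n g_{i,j,m}(x_m)$ is a sum of univariate polynomials and has degree $\le d$. If $|\mathbb{F}|\ge (4ndk^3e^4)^2$, then $\mathcal{SDC}$ has a $\mathrm{poly}(n,k,e,d)$-explicit hitting set $\mathcal{H}\subseteq\mathbb{F}^n$ of size $|\mathcal{H}|\le B:=(8nd^2k^4e^6)^{\lceil \lg n\rceil+1}$. Here $\mathcal{H}$ is a hitting set if every $f\in\mathcal{SDC}$ satisfies: $f=0$ as a polynomial if and only if $f$ vanishes on $\mathcal{H}$. Explicitness means the following. There are one program (a random access machine over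 $\mathbb{F}$) and one constant $c$, both independent of $\mathbb{F},n,k,e,d$, such that $\mathcal{H}$ can be indexed, possibly with repetitions, by $\{0,\dots,B-1\}$, and, given $n,k,e,d$ and an index, the program outputs the $n$ coordinates of the corresponding point of $\mathcal{H}$ in at most $c\,(n+k+e+d+1)^c$ steps. The machine computes with natural numbers (charged by bit length) and with elements of $\mathbb{F}$ (unit cost for $0,1,+,-,\times$, inverse and equality test), and it can call the $i$-th element of an arbitrary given enumeration, without repetition, of elements of $\mathbb{F}$ (of all of them if $\mathbb{F}$ is finite, of infinitely many if $\mathbb{F}$ is infinite) at a cost linear in the bit length of $i$. -/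

import Mathlib

/-! ## Semi-diagonal depth-4 circuits and hitting sets -/

/-- A semi-diagonal depth-4 circuit in `n` variables with top fan-in `k`:
`∑ i, m_i(x) * ∏ j, P_{i,j} ^ e_{i,j}`, where `m_i` is the monomial `coeff i * x ^ mono i` and
`P_{i,j} = ∑ m, g_{i,j,m}(x_m)` is a sum of univariate polynomials.  The number `width i` of
distinct factors of the `i`-th product gate is arbitrary. -/
structure SemiDiagonalCircuit (F : Type*) [Field F] (n k : ℕ) where
  coeff : Fin k → F
  mono : Fin k → (Fin n →₀ ℕ)
  width : Fin k → ℕ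
  g : (i : Fin k) → Fin (width i) → Fin n → Polynomial F
  expo : (i : Fin k) → Fin (width i) → ℕ

namespace SemiDiagonalCircuit

variable {F : Type*} [Field F] {n k : ℕ}

/-- `P_{i,j}(x) = ∑ m, g_{i,j,m}(x_m)`. -/
noncomputable def factor (Φ : SemiDiagonalCircuit F n k) (i : Fin k) (j : Fin (Φ.width i)) :
    MvPolynomial (Fin n) F :=
  ∑ m : Fin n, Polynomial.aeval (MvPolynomial.X m : MvPolynomial (Fin n) F) (Φ.g i j m)

/-- The polynomial computed by the circuit. -/
noncomputable def toPoly (Φ : SemiDiagonalCircuit F n k) : MvPolynomial (Fin n) F :=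
  ∑ i : Fin k, MvPolynomial.monomial (Φ.mono i) (Φ.coeff i) *
    ∏ j : Fin (Φ.width i), Φ.factor i j ^ Φ.expo i j

end SemiDiagonalCircuit

/-- The class of `n`-variate polynomials computed by semi-diagonal depth-4 circuits with top
fan-in `k`, with `∏ j, (1 + e_{i,j}) ≤ e` for every product gate, and whose monomials `m_i` and
polynomials `P_{i,j}` all have (total) degree at most `d`. -/
def semiDiagonalClass (F : Type*) [Field F] (n k e d : ℕ) : Set (MvPolynomial (Fin n) F) :=
  {f | ∃ Φ : SemiDiagonalCircuit F n k,
    (∀ i, (Φ.mono i).degree ≤ d) ∧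
    (∀ i, ∏ j, (1 + Φ.expo i j) ≤ e) ∧
    (∀ i j, (Φ.factor i j).totalDegree ≤ d) ∧
    Φ.toPoly = f}

/-- `H` is a hitting set for the class `C`: a member of `C` is the zero polynomial iff it vanishes
on `H`. -/
def IsHittingSet {F : Type*} [Field F] {n : ℕ} (C : Set (MvPolynomial (Fin n) F))
    (H : Set (Fin n → F)) : Prop :=
  ∀ f ∈ C, f = 0 ↔ ∀ x ∈ H, MvPolynomial.eval x f = 0

/-! ## Algebraic random access machines

Programs over an arbitrary field `F`.  The memory consists of arrays of natural numbers and arrays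
of field elements.  Operations on natural numbers are charged by the bit lengths of the numbers
and addresses involved (logarithmic cost); an operation or equality test in `F` costs one step.
Besides its operations, the field is given by an enumeration `ε` of its elements. -/

/-- `ε 0, ε 1, …` enumerates elements of `F` without repetition: the first `|F|` terms are
pairwise distinct (so they are all the elements of `F` if `F` is finite, and `ε` is injective if
`F` is infinite). -/
def IsEnumeration {F : Type*} (ε : ℕ → F) : Prop :=
  ∀ i j : ℕ, i < j → (j : ℕ∞) < ENat.card F → ε i ≠ ε j

namespace AlgRAM

/-- Memory: `nat a i` and `fld a i` are the `i`-th cells of the `a`-th arrays. -/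
structure State (F : Type*) where
  nat : ℕ → ℕ → ℕ
  fld : ℕ → ℕ → F

/-- Expressions for natural numbers; `get a i` reads cell `i` of the array named `a`. -/
inductive NatExpr where
  | const (c : ℕ)
  | get (a : ℕ) (i : NatExpr)
  | add (x y : NatExpr)
  | sub (x y : NatExpr)
  | mul (x y : NatExpr)
  | div (x y : NatExpr)
  | mod (x y : NatExpr)

/-- Expressions for field elements; `elem i` is the `i`-th term of the enumeration. -/
inductive FieldExpr where
  | zero
  | one
  | get (a : ℕ) (i : NatExpr)
  | elem (i : NatExpr)
  | add (x y : FieldExpr)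
  | sub (x y : FieldExpr)
  | mul (x y : FieldExpr)
  | inv (x : FieldExpr)

/-- Tests used for branching. -/
inductive Test where
  | natEq (x y : NatExpr)
  | natLt (x y : NatExpr)
  | fieldEq (x y : FieldExpr)

/-- Programs; they do not depend on the field.  `loop b p` runs `p` as long as `b` holds. -/
inductive Prog where
  | skip
  | setNat (a : ℕ) (i v : NatExpr)
  | setField (a : ℕ) (i : NatExpr) (v : FieldExpr)
  | seq (p q : Prog)
  | ite (b : Test) (p q : Prog)
  | loop (b : Test) (p : Prog)

section Semantics

variable {F : Type*}

def NatExpr.eval (s : State F) : NatExpr → ℕ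
  | const c => c
  | get a i => s.nat a (i.eval s)
  | add x y => x.eval s + y.eval s
  | sub x y => x.eval s - y.eval s
  | mul x y => x.eval s * y.eval s
  | div x y => x.eval s / y.eval s
  | mod x y => x.eval s % y.eval s

/-- Cost of evaluating an expression; `Nat.size` is the bit length. -/
def NatExpr.cost (s : State F) : NatExpr → ℕ
  | const c => 1 + c.size
  | get a i => i.cost s + 1 + (i.eval s).size + (s.nat a (i.eval s)).size
  | add x y => x.cost s + y.cost s + 1 + (x.eval s).size + (y.eval s).size
  | sub x y => x.cost s + y.cost s + 1 + (x.eval s).size + (y.eval s).size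
  | mul x y => x.cost s + y.cost s + 1 + (x.eval s).size + (y.eval s).size
  | div x y => x.cost s + y.cost s + 1 + (x.eval s).size + (y.eval s).size
  | mod x y => x.cost s + y.cost s + 1 + (x.eval s).size + (y.eval s).size

def FieldExpr.eval [Field F] (ε : ℕ → F) (s : State F) : FieldExpr → F
  | zero => 0
  | one => 1
  | get a i => s.fld a (i.eval s)
  | elem i => ε (i.eval s)
  | add x y => x.eval ε s + y.eval ε s
  | sub x y => x.eval ε s - y.eval ε s
  | mul x y => x.eval ε s * y.eval ε s
  | inv x => (x.eval ε s)⁻¹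

def FieldExpr.cost (s : State F) : FieldExpr → ℕ
  | zero => 1
  | one => 1
  | get _ i => i.cost s + 1 + (i.eval s).size
  | elem i => i.cost s + 1 + (i.eval s).size
  | add x y => x.cost s + y.cost s + 1
  | sub x y => x.cost s + y.cost s + 1
  | mul x y => x.cost s + y.cost s + 1
  | inv x => x.cost s + 1

def Test.holds [Field F] (ε : ℕ → F) (s : State F) : Test → Prop
  | natEq x y => x.eval s = y.eval s
  | natLt x y => x.eval s < y.eval s
  | fieldEq x y => x.eval ε s = y.eval ε s

def Test.cost (s : State F) : Test → ℕ
  | natEq x y => x.cost s + y.cost s + 1 + (x.eval s).size + (y.eval s).size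
  | natLt x y => x.cost s + y.cost s + 1 + (x.eval s).size + (y.eval s).size
  | fieldEq x y => x.cost s + y.cost s + 1

/-- Overwrite one cell of an array of natural numbers. -/
def State.writeNat (s : State F) (a i v : ℕ) : State F :=
  { s with nat := Function.update s.nat a (Function.update (s.nat a) i v) }

/-- Overwrite one cell of an array of field elements. -/
def State.writeField (s : State F) (a i : ℕ) (v : F) : State F :=
  { s with fld := Function.update s.fld a (Function.update (s.fld a) i v) }

/-- `Exec ε p s t s'`: started in state `s`, the program `p` halts in state `s'` after exactly `t`
time steps. -/
inductive Exec [Field F] (ε : ℕ → F) : Prog → State F → ℕ → State F → Prop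
  | skip (s : State F) : Exec ε .skip s 1 s
  | setNat (a : ℕ) (i v : NatExpr) (s : State F) :
      Exec ε (.setNat a i v) s (i.cost s + v.cost s + 1 + (i.eval s).size + (v.eval s).size)
        (s.writeNat a (i.eval s) (v.eval s))
  | setField (a : ℕ) (i : NatExpr) (v : FieldExpr) (s : State F) :
      Exec ε (.setField a i v) s (i.cost s + v.cost s + 1 + (i.eval s).size)
        (s.writeField a (i.eval s) (v.eval ε s))
  | seq (p q : Prog) (s s₁ s₂ : State F) (t₁ t₂ : ℕ) :
      Exec ε p s t₁ s₁ → Exec ε q s₁ t₂ s₂ → Exec ε (.seq p q) s (t₁ + t₂) s₂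
  | iteTrue (b : Test) (p q : Prog) (s s₁ : State F) (t : ℕ) :
      b.holds ε s → Exec ε p s t s₁ → Exec ε (.ite b p q) s (b.cost s + 1 + t) s₁
  | iteFalse (b : Test) (p q : Prog) (s s₁ : State F) (t : ℕ) :
      ¬ b.holds ε s → Exec ε q s t s₁ → Exec ε (.ite b p q) s (b.cost s + 1 + t) s₁
  | loopTrue (b : Test) (p : Prog) (s s₁ s₂ : State F) (t₁ t₂ : ℕ) :
      b.holds ε s → Exec ε p s t₁ s₁ → Exec ε (.loop b p) s₁ t₂ s₂ →
        Exec ε (.loop b p) s (b.cost s + 1 + t₁ + t₂) s₂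
  | loopFalse (b : Test) (p : Prog) (s : State F) :
      ¬ b.holds ε s → Exec ε (.loop b p) s (b.cost s + 1) s

/-- The inputs are in the first cells of array `0`; all other cells are zero. -/
def State.init [Field F] (inputs : List ℕ) : State F where
  nat := fun a i => if a = 0 then inputs.getD i 0 else 0
  fld := fun _ _ => 0

/-- On the given inputs, `p` halts within `t` steps with the vector `y` in the first `n` cells of
field array `0`. -/
def Computes [Field F] {n : ℕ} (ε : ℕ → F) (p : Prog) (inputs : List ℕ) (y : Fin n → F)
    (t : ℕ) : Prop :=
  ∃ t' ≤ t, ∃ s' : State F, Exec ε p (State.init inputs) t' s' ∧ ∀ j : Fin n, s'.fld 0 j = y j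

end Semantics

end AlgRAM

/-- `H` is `t`-explicit: its points are indexed (possibly with repetitions) by `0, …, N - 1`, and
from the parameters and an index the program `p` computes the corresponding point within `t`
steps. -/
def IsExplicit {F : Type*} [Field F] {n : ℕ} (ε : ℕ → F) (p : AlgRAM.Prog) (params : List ℕ)
    (N t : ℕ) (H : Set (Fin n → F)) : Prop :=
  ∃ pt : Fin N → Fin n → F, Set.range pt = H ∧
    ∀ i : Fin N, AlgRAM.Computes ε p (params ++ [(i : ℕ)]) (pt i) t

/-! ## Evaluating a space of univariate polynomials at the powers of one element -/

/-! Substitute univariate polynomials for the variables of a set `S` and constants for the others.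
Each factor is a sum of univariates, so it becomes `A + b` with `A` independent of the constants and
`b` a scalar. Expanding the powers shows that all restrictions, whatever the constants, lie in one
space of dimension at most `r = k * e` (`SemiDiagonalCircuit.exists_submodule_aeval_mem`). No
derivatives occur, so the characteristic is irrelevant.

On a space of univariate polynomials of dimension at most `r` and degree at most `K`, evaluation at
`α, …, α^r` is injective for all but `r²K` elements `α`. Indeed the space is spanned by elements `v
i` of increasing degrees, and in the determinant of the `v i (X^(a+1))` the diagonal alone reaches
the top degree, by the rearrangement inequality (`Polynomial.det_expand_ne_zero`).

At level `l` the variables are cut into blocks of `2^l` consecutive ones, and each block moves along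
a curve with its own parameter. For good `α l`, the parameters can be replaced one block at a time
by powers `α l ^ (a + 1)`, `a < r`, with `f` staying nonzero. Two neighbouring blocks then have only
`r²` pairs of parameters, and a curve interpolated through the corresponding points merges them into
one block with one parameter (`exists_finset_forall_eval_mergeCurve_ne_zero`). The curves have
degree at most `r²` at every level, so at most `n · r² · (d e r²) = n d k⁴ e⁵` values of `α l` are
bad.

After `⌈lg n⌉` levels a single parameter remains, and `f` has become a nonzero univariate
polynomial. The base `Q` digits of the index supply the elements `α l` and this last parameter,
which explains the exponent `⌈lg n⌉ + 1`. The program stores only the values of the current curve at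
`α l, …, (α l)^r`: these are the data of the next interpolation. -/

open Polynomial in
/-- A finite-dimensional space of univariate polynomials is contained in the span of some of its
elements having pairwise distinct degrees. -/
theorem Polynomial.exists_strictMono_natDegree_span {F : Type*} [Field F] (V : Submodule F F[X])
    (K r : ℕ) (hK : ∀ v ∈ V, v.natDegree ≤ K) (hr : Module.finrank F V ≤ r)
    [FiniteDimensional F V] :
    ∃ s ≤ r, ∃ v : Fin s → F[X], (∀ i, v i ∈ V) ∧ (∀ i, v i ≠ 0) ∧
      StrictMono (fun i => (v i).natDegree) ∧ V ≤ Submodule.span F (Set.range v) := by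
  classical
  -- The degrees that occur in `V`; one element of `V` is chosen for each. Distinct degrees force
  -- independence, hence at most `r` of them.
  set D : Finset ℕ := (Finset.range (K + 1)).filter (fun m => ∃ v ∈ V, v ≠ 0 ∧ v.natDegree = m)
    with hD
  have hmem : ∀ m ∈ D, ∃ v ∈ V, v ≠ 0 ∧ v.natDegree = m := fun m hm => (Finset.mem_filter.1 hm).2
  choose! w hwV hw0 hwd using hmem
  let o := D.orderEmbOfFin rfl
  have ho : ∀ i, o i ∈ D := fun i => D.orderEmbOfFin_mem rfl i
  let v : Fin D.card → F[X] := fun i => w (o i)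
  have hvd : ∀ i, (v i).natDegree = o i := fun i => hwd _ (ho i)
  have hmono : StrictMono (fun i => (v i).natDegree) := by
    intro i j hij
    simpa [hvd] using hij
  have hli : LinearIndependent F v := by
    rw [linearIndependent_iff']
    intro s g hg
    have hdeg := degree_sum_eq_of_disjoint (fun i => g i • v i) s (by
      rintro i ⟨-, hi⟩ j ⟨-, hj⟩ hij
      have hgi : g i ≠ 0 := fun h => hi (by simp [h])
      have hgj : g j ≠ 0 := fun h => hj (by simp [h])
      simp only [Function.onFun, Function.comp, smul_eq_C_mul, degree_C_mul hgi, degree_C_mul hgj,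
        degree_eq_natDegree (hw0 _ (ho _)), v]
      intro h
      exact hij (hmono.injective (by exact_mod_cast h)))
    rw [hg, degree_zero] at hdeg
    intro i hi
    by_contra hgi
    have h1 : (g i • v i).degree ≤ ⊥ := by
      rw [hdeg]
      exact Finset.le_sup (f := degree ∘ fun i => g i • v i) hi
    rw [le_bot_iff, degree_eq_bot] at h1
    exact (smul_ne_zero hgi (hw0 _ (ho i))) h1
  refine ⟨D.card, ?_, v, fun i => hwV _ (ho i), fun i => hw0 _ (ho i), hmono, ?_⟩
  · have hli' : LinearIndependent F (fun i => (⟨v i, hwV _ (ho i)⟩ : V)) :=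
      LinearIndependent.of_comp V.subtype hli
    simpa using hli'.fintype_card_le_finrank.trans hr
  -- Spanning: induction on the degree, cancelling the leading term with the chosen element of the
  -- same degree.
  · suffices h : ∀ m, ∀ p ∈ V, p.natDegree < m → p ∈ Submodule.span F (Set.range v) from
      fun p hp => h _ p hp (Nat.lt_succ_self _)
    intro m
    induction m with
    | zero => intro p _ h; omega
    | succ m ih =>
      intro p hp hpm
      by_cases hp0 : p = 0
      · simp [hp0]
      have hpD : p.natDegree ∈ D :=
        Finset.mem_filter.2 ⟨Finset.mem_range.2 (Nat.lt_succ_of_le (hK p hp)), p, hp, hp0, rfl⟩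
      have hwspan : w p.natDegree ∈ Submodule.span F (Set.range v) := by
        apply Submodule.subset_span
        have : p.natDegree ∈ Set.range o := by
          rw [Finset.range_orderEmbOfFin]; exact hpD
        obtain ⟨i, hi⟩ := this
        exact ⟨i, by simp [v, hi]⟩
      set q := w p.natDegree with hq
      have hq0 : q ≠ 0 := hw0 _ hpD
      have hqd : q.natDegree = p.natDegree := hwd _ hpD
      set c := p.leadingCoeff / q.leadingCoeff with hc
      have hc0 : c ≠ 0 := div_ne_zero (leadingCoeff_ne_zero.2 hp0) (leadingCoeff_ne_zero.2 hq0)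
      have hsub : p - c • q ∈ Submodule.span F (Set.range v) := by
        have hV : p - c • q ∈ V := V.sub_mem hp (V.smul_mem _ (hwV _ hpD))
        by_cases hz : p - c • q = 0
        · rw [hz]; exact Submodule.zero_mem _
        apply ih _ hV
        have hlt : (p - c • q).degree < p.degree := by
          apply degree_sub_lt_left
          · rw [smul_eq_C_mul, degree_C_mul hc0, degree_eq_natDegree hp0, degree_eq_natDegree hq0,
              hqd]
          · exact hp0
          · rw [smul_eq_C_mul, leadingCoeff_mul, leadingCoeff_C, hc,
              div_mul_cancel₀ _ (leadingCoeff_ne_zero.2 hq0)]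
        have := natDegree_lt_natDegree hz hlt
        omega
      have := Submodule.add_mem _ hsub (Submodule.smul_mem _ c hwspan)
      simpa using this

open Polynomial in
theorem Polynomial.coeff_prod_sum_of_natDegree_le {F ι : Type*} [CommRing F] (s : Finset ι)
    (p : ι → F[X]) (m : ι → ℕ) (h : ∀ i ∈ s, (p i).natDegree ≤ m i) :
    (∏ i ∈ s, p i).coeff (∑ i ∈ s, m i) = ∏ i ∈ s, (p i).coeff (m i) := by
  classical
  induction s using Finset.induction_on with
  | empty => simp
  | insert a s ha ih =>
    rw [Finset.prod_insert ha, Finset.sum_insert ha, Finset.prod_insert ha,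
      coeff_mul_add_eq_of_natDegree_le (h a (Finset.mem_insert_self _ _)),
      ih fun i hi => h i (Finset.mem_insert_of_mem hi)]
    exact (natDegree_prod_le _ _).trans
      (Finset.sum_le_sum fun i hi => h i (Finset.mem_insert_of_mem hi))

open Polynomial in
/-- The generalized Vandermonde determinant of polynomials with distinct degrees at the powers
`X, X², …, Xˢ` does not vanish. -/
theorem Polynomial.det_expand_ne_zero {F : Type*} [Field F] {s : ℕ} (v : Fin s → F[X])
    (h0 : ∀ i, v i ≠ 0) (hmono : StrictMono fun i => (v i).natDegree) :
    (Matrix.of fun a i : Fin s => (v i).comp (X ^ ((a : ℕ) + 1))).det ≠ 0 := by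
  classical
  intro hdet
  have hdeg : ∀ a i : Fin s, ((v i).comp (X ^ ((a : ℕ) + 1))).natDegree
      = (v i).natDegree * ((a : ℕ) + 1) := fun a i => by rw [natDegree_comp, natDegree_X_pow]
  -- This is the degree of the diagonal product, so its coefficient there is a product of leading
  -- coefficients.
  have hco := congrArg (fun q => q.coeff (∑ i : Fin s, (v i).natDegree * ((i : ℕ) + 1))) hdet
  simp only [Matrix.det_apply, finsetSum_coeff, coeff_zero, coeff_smul, Matrix.of_apply] at hco
  rw [Finset.sum_eq_single (1 : Equiv.Perm (Fin s))] at hco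
  · simp only [Equiv.Perm.sign_one, one_smul, Equiv.Perm.one_apply] at hco
    rw [coeff_prod_sum_of_natDegree_le _ _ _ fun i _ => (hdeg i i).le] at hco
    rw [Finset.prod_eq_zero_iff] at hco
    obtain ⟨i, -, hi⟩ := hco
    rw [← hdeg i i, ← leadingCoeff, leadingCoeff_eq_zero] at hi
    rw [comp_eq_zero_iff] at hi
    rcases hi with hi | ⟨-, hi⟩
    · exact h0 i hi
    · have := congrArg natDegree hi
      simp at this
  · intro σ _ hσ
    rw [coeff_eq_zero_of_natDegree_lt, smul_zero]
    refine (natDegree_prod_le _ _).trans_lt ?_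
    simp only [hdeg]
    have hm : Monovary (fun i => (v i).natDegree) (fun i : Fin s => (i : ℕ) + 1) := by
      intro i j hij
      exact hmono.monotone (by simp only [add_lt_add_iff_right, Fin.val_fin_lt] at hij; exact hij.le)
    -- Equality in the rearrangement inequality would make `σ` monotone, hence the identity.
    refine (hm.sum_mul_comp_perm_lt_sum_mul_iff (σ := σ)).2 fun hm' => hσ ?_
    have hσm : StrictMono σ := by
      have : Monotone σ := by
        intro i j hij
        by_contra hlt
        push Not at hlt
        have h1 := hm' (i := j) (j := i) (by simpa using hlt)
        have h2 := hmono.le_iff_le.1 h1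
        exact absurd (le_antisymm hij h2) (fun h => by subst h; exact lt_irrefl _ hlt)
      exact this.strictMono_of_injective σ.injective
    ext i
    have := congrFun ((hσm.range_inj strictMono_id).1 (by simp [σ.surjective.range_eq])) i
    simpa using congrArg Fin.val this
  · simp

open Polynomial in
/-- For all but few `α`, no nonzero element of the space `V` of polynomials vanishes at all of
`α, α², …, α^r`, where `r` bounds the dimension of `V`. -/
theorem Polynomial.exists_finset_forall_eval_pow_eq_zero {F : Type*} [Field F]
    (V : Submodule F F[X]) (K r : ℕ) (hK : ∀ v ∈ V, v.natDegree ≤ K)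
    (hr : Module.finrank F V ≤ r) [FiniteDimensional F V] :
    ∃ B : Finset F, B.card ≤ r * r * K ∧ ∀ α ∉ B, ∀ v ∈ V,
      (∀ a < r, v.eval (α ^ (a + 1)) = 0) → v = 0 := by
  classical
  obtain ⟨s, hs, v, hvV, hv0, hmono, hspan⟩ := exists_strictMono_natDegree_span V K r hK hr
  set M := Matrix.of fun a i : Fin s => (v i).comp (X ^ ((a : ℕ) + 1)) with hM
  -- The bad `α` are the roots of the determinant: `s ≤ r` columns, each of degree at most `r * K`.
  refine ⟨M.det.roots.toFinset, ?_, ?_⟩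
  · refine (Multiset.toFinset_card_le _).trans ((card_roots' _).trans ?_)
    rw [Matrix.det_apply]
    refine natDegree_sum_le_of_forall_le _ _ fun σ _ => ?_
    refine (natDegree_smul_le _ _).trans ((natDegree_prod_le _ _).trans ?_)
    calc ∑ i : Fin s, (M (σ i) i).natDegree ≤ ∑ i : Fin s, r * K := by
          refine Finset.sum_le_sum fun i _ => ?_
          rw [hM, Matrix.of_apply, natDegree_comp, natDegree_X_pow, mul_comm]
          exact Nat.mul_le_mul (by have := (σ i).isLt; omega) (hK _ (hvV i))
      _ ≤ r * r * K := by
          rw [Finset.sum_const, Finset.card_univ, Fintype.card_fin, smul_eq_mul, mul_assoc]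
          exact Nat.mul_le_mul_right _ hs
  · intro α hα p hp hz
    have hdet : M.det.eval α ≠ 0 := by
      intro h
      exact hα (by simpa [det_expand_ne_zero v hv0 hmono, hM] using h)
    obtain ⟨c, rfl⟩ := (Submodule.mem_span_range_iff_exists_fun F).1 (hspan hp)
    have hmul : (M.map (evalRingHom α)).mulVec c = 0 := by
      ext a
      have := hz a (a.isLt.trans_le hs)
      simp only [eval_finsetSum, eval_smul, smul_eq_mul] at this
      simp only [Matrix.mulVec, dotProduct, Matrix.map_apply, hM, Matrix.of_apply, coe_evalRingHom,
        eval_comp, eval_pow, eval_X, Pi.zero_apply]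
      rw [← this]
      exact Finset.sum_congr rfl fun i _ => mul_comm _ _
    have hc : c = 0 := Matrix.eq_zero_of_mulVec_eq_zero (by
      rw [← RingHom.mapMatrix_apply, ← RingHom.map_det]; exact hdet) hmul
    simp [hc]

/-! ## Semi-diagonal circuits: degree and dimension of restrictions -/

namespace SemiDiagonalCircuit

variable {F : Type*} [Field F] {n k : ℕ}

/-- A product gate has degree at most `d (1 + ∑ e_j)`, and `1 + ∑ e_j ≤ ∏ (1 + e_j) ≤ e`. -/
theorem totalDegree_toPoly_le (Φ : SemiDiagonalCircuit F n k) (d e : ℕ)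
    (hm : ∀ i, (Φ.mono i).degree ≤ d) (he : ∀ i, ∏ j, (1 + Φ.expo i j) ≤ e)
    (hd : ∀ i j, (Φ.factor i j).totalDegree ≤ d) : Φ.toPoly.totalDegree ≤ d * e := by
  refine (MvPolynomial.totalDegree_finsetSum _ _).trans (Finset.sup_le fun i _ => ?_)
  refine (MvPolynomial.totalDegree_mul _ _).trans ?_
  have h1 : (MvPolynomial.monomial (Φ.mono i) (Φ.coeff i)).totalDegree ≤ d :=
    (MvPolynomial.totalDegree_monomial_le _ _).trans (hm i)
  have h2 : (∏ j, Φ.factor i j ^ Φ.expo i j).totalDegree ≤ d * ∑ j, Φ.expo i j := by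
    refine (MvPolynomial.totalDegree_finsetProd _ _).trans ?_
    rw [Finset.mul_sum]
    refine Finset.sum_le_sum fun j _ => (MvPolynomial.totalDegree_pow _ _).trans ?_
    rw [mul_comm]
    exact Nat.mul_le_mul_right _ (hd i j)
  have h3 : 1 + ∑ j, Φ.expo i j ≤ e := by
    refine le_trans ?_ (he i)
    have : ∀ s : Finset (Fin (Φ.width i)), 1 + ∑ j ∈ s, Φ.expo i j ≤ ∏ j ∈ s, (1 + Φ.expo i j) := by
      intro s
      induction s using Finset.induction_on with
      | empty => simp
      | insert a s ha ih =>
        rw [Finset.sum_insert ha, Finset.prod_insert ha]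
        nlinarith [Nat.zero_le (Φ.expo i a), Nat.zero_le (∑ j ∈ s, Φ.expo i j),
          Nat.mul_le_mul_left (1 + Φ.expo i a) ih,
          Nat.zero_le (Φ.expo i a * ∑ j ∈ s, Φ.expo i j)]
    exact this _
  calc _ ≤ d + d * ∑ j, Φ.expo i j := add_le_add h1 h2
    _ = d * (1 + ∑ j, Φ.expo i j) := by ring
    _ ≤ d * e := Nat.mul_le_mul_left _ h3

open Polynomial in
/-- Substitute univariate polynomials for the variables in `S`, and constants for the others: all
results lie in a space of dimension at most `k * e`. -/
theorem exists_submodule_aeval_mem (Φ : SemiDiagonalCircuit F n k) (e : ℕ)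
    (he : ∀ i, ∏ j, (1 + Φ.expo i j) ≤ e) (S : Fin n → Prop) [DecidablePred S] (γ : Fin n → F[X]) :
    ∃ W : Submodule F F[X], FiniteDimensional F W ∧ Module.finrank F W ≤ k * e ∧
      ∀ c : Fin n → F,
        MvPolynomial.aeval (fun j => if S j then γ j else C (c j)) Φ.toPoly ∈ W := by
  classical
  -- One generator for each gate and each vector of exponents `x j ≤ e_{i,j}`: at most `e` per gate.
  let ι := Σ i : Fin k, ((j : Fin (Φ.width i)) → Fin (Φ.expo i j + 1))
  let A : (i : Fin k) → Fin (Φ.width i) → F[X] := fun i j =>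
    ∑ m ∈ Finset.univ.filter S, aeval (γ m) (Φ.g i j m)
  let m₀ : Fin k → F[X] := fun i => ∏ m ∈ Finset.univ.filter S, γ m ^ Φ.mono i m
  let w : ι → F[X] := fun x => m₀ x.1 * ∏ j, A x.1 j ^ (x.2 j : ℕ)
  refine ⟨Submodule.span F (Set.range w), FiniteDimensional.span_of_finite F (Set.finite_range w),
    ?_, ?_⟩
  · refine (finrank_range_le_card w).trans ?_
    simp only [ι, Fintype.card_sigma, Fintype.card_pi, Fintype.card_fin]
    calc _ ≤ ∑ _i : Fin k, e := Finset.sum_le_sum fun i _ => by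
          simpa [add_comm] using he i
      _ = k * e := by simp
  · intro c
    set φ := MvPolynomial.aeval (R := F) (fun j => if S j then γ j else C (c j)) with hφ
    rw [toPoly, map_sum]
    refine Submodule.sum_mem _ fun i _ => ?_
    have hmono : φ (MvPolynomial.monomial (Φ.mono i) (Φ.coeff i)) =
        C (Φ.coeff i * ∏ m ∈ Finset.univ.filter (fun m => ¬ S m), c m ^ Φ.mono i m) * m₀ i := by
      rw [hφ, MvPolynomial.aeval_monomial, Finsupp.prod_fintype _ _ (by simp),
        ← Finset.prod_filter_mul_prod_filter_not Finset.univ S, C_mul, map_prod,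
        Finset.prod_congr rfl (g := fun m => γ m ^ Φ.mono i m)
          (fun m hm => by rw [if_pos (Finset.mem_filter.1 hm).2]),
        Finset.prod_congr (s₁ := Finset.univ.filter (fun m => ¬ S m)) rfl
          (g := fun m => C (c m ^ Φ.mono i m))
          (fun m hm => by rw [if_neg (Finset.mem_filter.1 hm).2, C_pow])]
      simp only [m₀, algebraMap_eq]
      ring
    -- The constants enter a factor only through this scalar, so the binomial theorem separates them
    -- from the powers of `A i j`.
    let b : Fin (Φ.width i) → F := fun j =>
      ∑ m ∈ Finset.univ.filter (fun m => ¬ S m), (Φ.g i j m).eval (c m)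
    have hfac : ∀ j, φ (Φ.factor i j) = A i j + C (b j) := by
      intro j
      rw [factor, map_sum, ← Finset.sum_filter_add_sum_filter_not Finset.univ S]
      simp only [A, b, map_sum]
      congr 1
      · refine Finset.sum_congr rfl fun m hm => ?_
        rw [← aeval_algHom_apply, hφ, MvPolynomial.aeval_X, if_pos (Finset.mem_filter.1 hm).2]
      · refine Finset.sum_congr rfl fun m hm => ?_
        rw [← aeval_algHom_apply, hφ, MvPolynomial.aeval_X, if_neg (Finset.mem_filter.1 hm).2]
        exact aeval_algebraMap_apply F[X] (c m) (Φ.g i j m)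
    rw [map_mul, map_prod, hmono]
    have hprod : ∏ j, φ (Φ.factor i j ^ Φ.expo i j) =
        ∑ x : ((j : Fin (Φ.width i)) → Fin (Φ.expo i j + 1)),
          C (∏ j, (b j ^ (Φ.expo i j - x j) * (Φ.expo i j).choose (x j))) *
            ∏ j, A i j ^ (x j : ℕ) := by
      have h1 : ∀ j, φ (Φ.factor i j ^ Φ.expo i j) = ∑ a : Fin (Φ.expo i j + 1),
          C (b j ^ (Φ.expo i j - a) * (Φ.expo i j).choose a) * A i j ^ (a : ℕ) := by
        intro j
        rw [map_pow, hfac, add_pow, Finset.sum_range]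
        refine Finset.sum_congr rfl fun a _ => ?_
        rw [C_mul, C_pow, C_eq_natCast]
        ring
      rw [Finset.prod_congr rfl fun j _ => h1 j, Finset.prod_univ_sum, Fintype.piFinset_univ]
      refine Finset.sum_congr rfl fun x _ => ?_
      rw [Finset.prod_mul_distrib, map_prod]
    rw [hprod, Finset.mul_sum]
    refine Submodule.sum_mem _ fun x _ => ?_
    rw [show ∀ p q s t : F[X], p * q * (s * t) = (p * s) * (q * t) from fun p q s t => by ring,
      ← C_mul, ← smul_eq_C_mul]
    exact Submodule.smul_mem _ _ (Submodule.subset_span ⟨⟨i, x⟩, rfl⟩)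

end SemiDiagonalCircuit

open Polynomial in
/-- Under a substitution of univariate polynomials for the variables in `S` and constants for the
others, the members of the class are determined by their values at the powers of almost every
element. -/
theorem exists_finset_forall_aeval_eval_pow {F : Type*} [Field F] {n k e d R : ℕ}
    {f : MvPolynomial (Fin n) F} (hf : f ∈ semiDiagonalClass F n k e d) (S : Fin n → Prop)
    [DecidablePred S] (γ : Fin n → F[X]) (hγ : ∀ j, (γ j).natDegree ≤ R) :
    ∃ B : Finset F, B.card ≤ (k * e) * (k * e) * (d * e * R) ∧ ∀ α ∉ B, ∀ c : Fin n → F,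
      (∀ a < k * e, (MvPolynomial.aeval (fun j => if S j then γ j else C (c j)) f).eval
        (α ^ (a + 1)) = 0) →
      MvPolynomial.aeval (fun j => if S j then γ j else C (c j)) f = 0 := by
  obtain ⟨Φ, hm, he, hd, rfl⟩ := hf
  obtain ⟨W, hWf, hWr, hW⟩ := Φ.exists_submodule_aeval_mem e he S γ
  -- Spanning over all `c` at once makes the exceptional set independent of `c`. The dimension bound
  -- comes from `W`, the degree bound from the circuit.
  set V := Submodule.span F (Set.range fun c : Fin n → F =>
    MvPolynomial.aeval (fun j => if S j then γ j else C (c j)) Φ.toPoly) with hV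
  have hVW : V ≤ W := Submodule.span_le.2 (by rintro _ ⟨c, rfl⟩; exact hW c)
  have : FiniteDimensional F V := Submodule.finiteDimensional_of_le hVW
  have hVK : V ≤ degreeLE F ((d * e * R : ℕ) : WithBot ℕ) := by
    refine Submodule.span_le.2 ?_
    rintro _ ⟨c, rfl⟩
    rw [SetLike.mem_coe, mem_degreeLE, ← natDegree_le_iff_degree_le]
    refine MvPolynomial.aeval_natDegree_le _ (Φ.totalDegree_toPoly_le d e hm he hd) _ fun j => ?_
    split_ifs
    · exact hγ j
    · simp
  obtain ⟨B, hB, h⟩ := exists_finset_forall_eval_pow_eq_zero V (d * e * R) (k * e)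
    (fun v hv => natDegree_le_iff_degree_le.2 (mem_degreeLE.1 (hVK hv)))
    ((Submodule.finrank_mono hVW).trans hWr)
  exact ⟨B, hB, fun α hα c => h α hα _ (Submodule.subset_span ⟨c, rfl⟩)⟩

/-! ## The generator -/

section Generator

variable {F : Type*} [Field F]

/-- The `l`-th digit of `i` in base `Q`, as an element of the field. -/
def seed (ε : ℕ → F) (Q i l : ℕ) : F := ε (i / Q ^ l % Q)

open Polynomial in
/-- The `j`-th coordinate of the curve of level `l`.  The curve of level `l + 1` runs through all
pairs of points of the previous curve with parameters `α, …, α^r`, where `α = α l`. -/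
noncomputable def mergeCurve (ε : ℕ → F) (r : ℕ) (α : ℕ → F) : ℕ → ℕ → F[X]
  | 0, _ => X
  | l + 1, j => Lagrange.interpolate (Finset.range (r * r)) ε fun m =>
      (mergeCurve ε r α l j).eval (α l ^ ((if j / 2 ^ l % 2 = 1 then m % r else m / r) + 1))

/-- Allows the elements `α l` to be chosen level by level: a later choice cannot alter a curve
already built. -/
theorem mergeCurve_congr (ε : ℕ → F) (r : ℕ) {α β : ℕ → F} {l : ℕ} (h : ∀ i < l, α i = β i)
    (j : ℕ) : mergeCurve ε r α l j = mergeCurve ε r β l j := by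
  induction l with
  | zero => rfl
  | succ l ih =>
    simp only [mergeCurve]
    rw [ih fun i hi => h i (hi.trans (Nat.lt_succ_self l)), h l (Nat.lt_succ_self l)]

omit [Field F] in
theorem IsEnumeration.injOn {ε : ℕ → F} (hε : IsEnumeration ε) {T : ℕ}
    (hT : (T : ℕ∞) ≤ ENat.card F) : Set.InjOn ε (Finset.range T) := by
  have key : ∀ i j, i < j → j < T → ε i ≠ ε j := fun i j hij hj =>
    hε i j hij (lt_of_lt_of_le (by exact_mod_cast hj) hT)
  intro i hi j hj hij
  simp only [Finset.coe_range, Set.mem_Iio] at hi hj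
  rcases lt_trichotomy i j with h | h | h
  · exact absurd hij (key i j h hj)
  · exact h
  · exact absurd hij.symm (key j i h hi)

omit [Field F] in
theorem IsEnumeration.exists_lt_notMem {ε : ℕ → F} (hε : IsEnumeration ε) {T : ℕ}
    (hT : (T : ℕ∞) ≤ ENat.card F) (B : Finset F) (hB : B.card < T) : ∃ s < T, ε s ∉ B := by
  classical
  by_contra h
  push Not at h
  have h1 : (Finset.range T).image ε ⊆ B := by
    intro x hx
    obtain ⟨s, hs, rfl⟩ := Finset.mem_image.1 hx
    exact h s (Finset.mem_range.1 hs)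
  have h2 := Finset.card_le_card h1
  rw [Finset.card_image_of_injOn (hε.injOn hT), Finset.card_range] at h2
  omega

/-- Interpolation through `r²` nodes resets the degree, so the bound does not grow with the level.
-/
theorem natDegree_mergeCurve_le {ε : ℕ → F} {r : ℕ} (hr : 1 ≤ r)
    (hinj : Set.InjOn ε (Finset.range (r * r))) (α : ℕ → F) (l j : ℕ) :
    (mergeCurve ε r α l j).natDegree ≤ r * r := by
  cases l with
  | zero => simpa [mergeCurve] using Nat.mul_le_mul hr hr
  | succ l =>
    rw [mergeCurve]
    refine Polynomial.natDegree_le_of_degree_le (le_of_lt ?_)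
    simpa using Lagrange.degree_interpolate_lt (s := Finset.range (r * r)) (v := ε) _ hinj

/-- The node numbered `r * a + b` encodes the pair `(a, b)`; bit `l` of `j` tells which half of the
merged block contains the coordinate. -/
theorem eval_mergeCurve_succ {ε : ℕ → F} {r : ℕ}
    (hinj : Set.InjOn ε (Finset.range (r * r))) (α : ℕ → F) (l j a b : ℕ) (ha : a < r)
    (hb : b < r) : (mergeCurve ε r α (l + 1) j).eval (ε (r * a + b)) =
      (mergeCurve ε r α l j).eval (α l ^ ((if j / 2 ^ l % 2 = 1 then b else a) + 1)) := by
  rw [mergeCurve, Lagrange.eval_interpolate_at_node _ hinj (Finset.mem_range.2 (by nlinarith))]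
  rw [Nat.mul_add_mod, Nat.mod_eq_of_lt hb, Nat.mul_add_div (by omega), Nat.div_eq_of_lt hb,
    add_zero]

theorem MvPolynomial.eval_aeval_polynomial {σ : Type*} (g : σ → Polynomial F)
    (f : MvPolynomial σ F) (x : F) :
    (MvPolynomial.aeval g f).eval x = f.eval fun j => (g j).eval x := by
  rw [← Polynomial.coe_aeval_eq_eval]
  change (Polynomial.aeval x) (MvPolynomial.aeval g f) = _
  rw [MvPolynomial.comp_aeval_apply, MvPolynomial.aeval_eq_eval]

variable {n k e d : ℕ} {f : MvPolynomial (Fin n) F}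

theorem exists_eval_ne_zero_of_mem_semiDiagonalClass (hf : f ∈ semiDiagonalClass F n k e d)
    (hf0 : f ≠ 0) {ε : ℕ → F} (hε : IsEnumeration ε) {T : ℕ}
    (hT : (T : ℕ∞) ≤ ENat.card F) (hdT : d * e < T) : ∃ z : Fin n → F, f.eval z ≠ 0 := by
  classical
  by_contra h
  push Not at h
  obtain ⟨Φ, hm, he, hd, rfl⟩ := hf
  refine hf0 (MvPolynomial.eq_zero_of_eval_zero_at_prod_finset _
    (fun _ => (Finset.range T).image ε) (fun i => ?_) fun x _ => h x)
  rw [Finset.card_image_of_injOn (hε.injOn hT), Finset.card_range]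
  exact ((MvPolynomial.degreeOf_le_totalDegree _ i).trans
    (Φ.totalDegree_toPoly_le d e hm he hd)).trans_lt hdT

/-- Passing from one level to the next preserves nonvanishing, unless `α l` is one of few elements
determined by the previous levels. -/
theorem exists_finset_forall_eval_mergeCurve_ne_zero (hf : f ∈ semiDiagonalClass F n k e d)
    {ε : ℕ → F} (hr : 1 ≤ k * e) (hinj : Set.InjOn ε (Finset.range (k * e * (k * e))))
    (α : ℕ → F) (l : ℕ) (z : ℕ → F)
    (hz : f.eval (fun j : Fin n => (mergeCurve ε (k * e) α l j).eval (z (j / 2 ^ l))) ≠ 0) :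
    ∃ B : Finset F, B.card ≤ n * ((k * e) * (k * e) * (d * e * (k * e * (k * e)))) ∧
      ∀ β : ℕ → F, (∀ i < l, β i = α i) → β l ∉ B → ∃ z' : ℕ → F,
        f.eval (fun j : Fin n => (mergeCurve ε (k * e) β (l + 1) j).eval (z' (j / 2 ^ (l + 1))))
          ≠ 0 := by
  classical
  set r := k * e with hrdef
  -- One exceptional set per block `t`. It does not depend on the parameters of the other blocks,
  -- which may therefore already involve `β l`.
  choose B hBc hB using fun t : ℕ => exists_finset_forall_aeval_eval_pow hf
    (fun j : Fin n => (j : ℕ) / 2 ^ l = t) (fun j => mergeCurve ε r α l j)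
    (fun j => natDegree_mergeCurve_le hr hinj α l j)
  refine ⟨(Finset.range n).biUnion B, ?_, ?_⟩
  · refine Finset.card_biUnion_le.trans ?_
    refine (Finset.sum_le_card_nsmul _ _ _ fun t _ => hBc t).trans ?_
    simp [← hrdef]
  intro β hβ hβB
  have hβB' : ∀ t < n, β l ∉ B t := fun t ht h =>
    hβB (Finset.mem_biUnion.2 ⟨t, Finset.mem_range.2 ht, h⟩)
  -- Hybrid argument: the first `t` blocks already have powers of `β l` as parameters, the others
  -- keep their old ones.
  have step : ∀ t ≤ n, ∃ z : ℕ → F, (∀ b < t, ∃ a < r, z b = β l ^ (a + 1)) ∧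
      f.eval (fun j : Fin n => (mergeCurve ε r α l j).eval (z (j / 2 ^ l))) ≠ 0 := by
    intro t
    induction t with
    | zero => exact fun _ => ⟨z, by simp, hz⟩
    | succ t ih =>
      intro ht
      obtain ⟨y, hy, hy0⟩ := ih (by omega)
      set c : Fin n → F := fun j => (mergeCurve ε r α l j).eval (y (j / 2 ^ l)) with hc
      have heval : ∀ x : F, (MvPolynomial.aeval (fun j : Fin n => if (j : ℕ) / 2 ^ l = t
          then mergeCurve ε r α l j else Polynomial.C (c j)) f).eval x =
          f.eval (fun j : Fin n =>
            (mergeCurve ε r α l j).eval (Function.update y t x (j / 2 ^ l))) := by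
        intro x
        rw [MvPolynomial.eval_aeval_polynomial]
        congr 2
        funext j
        by_cases hj : (j : ℕ) / 2 ^ l = t
        · simp [hj]
        · simp [hj, hc]
      by_contra hcon
      push Not at hcon
      have hzero := hB t (β l) (hβB' t (by omega)) c (fun a ha => by
        rw [heval]
        refine hcon (Function.update y t (β l ^ (a + 1))) fun b hb => ?_
        by_cases hbt : b = t
        · exact ⟨a, ha, by simp [hbt]⟩
        · obtain ⟨a', ha', h'⟩ := hy b (by omega)
          exact ⟨a', ha', by simp [hbt, h']⟩)
      have := heval (y t)
      rw [hzero, Function.update_eq_self] at this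
      exact hy0 (by simpa using this.symm)
  obtain ⟨y, hy, hy0⟩ := step n le_rfl
  -- Block numbers are below `n`; the default `0` elsewhere only makes `a` total with values below
  -- `r`.
  have hy' : ∀ b, ∃ a < r, b < n → y b = β l ^ (a + 1) := fun b => by
    by_cases hb : b < n
    · obtain ⟨a, ha, h⟩ := hy b hb
      exact ⟨a, ha, fun _ => h⟩
    · exact ⟨0, by omega, fun h => absurd h hb⟩
  choose a har hya using hy'
  refine ⟨fun b => ε (r * a (2 * b) + a (2 * b + 1)), ?_⟩
  convert hy0 using 3
  funext j
  rw [eval_mergeCurve_succ hinj β l j _ _ (har _) (har _), mergeCurve_congr ε r hβ,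
    hya _ ((Nat.div_le_self _ _).trans_lt j.isLt)]
  have h2 : (j : ℕ) / 2 ^ (l + 1) = (j : ℕ) / 2 ^ l / 2 := by
    rw [pow_succ, Nat.div_div_eq_div_mul]
  rw [h2]
  congr 3
  split_ifs with h
  · congr 1; omega
  · congr 1; omega

omit [Field F] in
theorem seed_add_mul_pow_of_lt (ε : ℕ → F) {Q : ℕ} (hQ : 0 < Q) (i s : ℕ) {l l' : ℕ}
    (h : l' < l) : seed ε Q (i + s * Q ^ l) l' = seed ε Q i l' := by
  unfold seed
  obtain ⟨m, rfl⟩ := Nat.exists_eq_add_of_lt h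
  rw [show i + s * Q ^ (l' + m + 1) = i + Q ^ l' * (Q * (s * Q ^ m)) by ring,
    Nat.add_mul_div_left _ _ (by positivity), Nat.add_mul_mod_self_left]

omit [Field F] in
theorem seed_add_mul_pow_self (ε : ℕ → F) {Q : ℕ} {i s l : ℕ} (hi : i < Q ^ l)
    (hs : s < Q) : seed ε Q (i + s * Q ^ l) l = ε s := by
  unfold seed
  rw [Nat.add_mul_div_right _ _ (by omega), Nat.div_eq_of_lt hi, zero_add, Nat.mod_eq_of_lt hs]

/-- The digits are fixed from the lowest up: each new one avoids fewer than `T` bad elements and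
leaves the lower digits unchanged. -/
theorem exists_seed_eval_mergeCurve_ne_zero (hf : f ∈ semiDiagonalClass F n k e d) (hf0 : f ≠ 0)
    {ε : ℕ → F} (hε : IsEnumeration ε) (hn : 1 ≤ n) (hk : 1 ≤ k) (he : 1 ≤ e)
    {T Q : ℕ} (hT : (T : ℕ∞) ≤ ENat.card F)
    (hTd : n * ((k * e) * (k * e) * (d * e * (k * e * (k * e)))) < T)
    (hrT : k * e * (k * e) ≤ T) (hTQ : T ≤ Q) :
    ∃ i < Q ^ (Nat.clog 2 n + 1), f.eval (fun j : Fin n =>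
      (mergeCurve ε (k * e) (seed ε Q i) (Nat.clog 2 n) j).eval
        (seed ε Q i (Nat.clog 2 n))) ≠ 0 := by
  classical
  have hr : 1 ≤ k * e := Nat.mul_pos hk he
  have hrr : 1 ≤ k * e * (k * e) := Nat.mul_pos hr hr
  have hinj : Set.InjOn ε (Finset.range (k * e * (k * e))) :=
    (hε.injOn hT).mono (by simpa using hrT)
  have hdeT : d * e * (k * e * (k * e)) < T := by
    refine lt_of_le_of_lt ?_ hTd
    calc d * e * (k * e * (k * e)) = 1 * (1 * (d * e * (k * e * (k * e)))) := by ring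
      _ ≤ _ := Nat.mul_le_mul hn (Nat.mul_le_mul_right _ hrr)
  have main : ∀ l, ∃ i < Q ^ l, ∃ z : ℕ → F, f.eval (fun j : Fin n =>
      (mergeCurve ε (k * e) (seed ε Q i) l j).eval (z (j / 2 ^ l))) ≠ 0 := by
    intro l
    induction l with
    | zero =>
      obtain ⟨z, hz⟩ := exists_eval_ne_zero_of_mem_semiDiagonalClass hf hf0 hε hT
        (lt_of_le_of_lt (Nat.le_mul_of_pos_right _ hrr) hdeT)
      refine ⟨0, by simp, fun b => if h : b < n then z ⟨b, h⟩ else 0, ?_⟩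
      simpa [mergeCurve] using hz
    | succ l ih =>
      obtain ⟨i, hi, z, hz⟩ := ih
      obtain ⟨B, hBc, hB⟩ := exists_finset_forall_eval_mergeCurve_ne_zero hf hr hinj _ l z hz
      obtain ⟨s, hs, hsB⟩ := hε.exists_lt_notMem hT B (hBc.trans_lt hTd)
      refine ⟨i + s * Q ^ l, ?_, hB _ (fun l' hl' => seed_add_mul_pow_of_lt ε (by omega) i s hl') ?_⟩
      · calc i + s * Q ^ l < Q ^ l + s * Q ^ l := by omega
          _ = (s + 1) * Q ^ l := by ring
          _ ≤ Q * Q ^ l := Nat.mul_le_mul_right _ (by omega)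
          _ = Q ^ (l + 1) := by ring
      · rwa [seed_add_mul_pow_self ε hi (by omega)]
  set L := Nat.clog 2 n with hL
  obtain ⟨i, hi, z, hz⟩ := main L
  have hnL : n ≤ 2 ^ L := Nat.le_pow_clog (by norm_num) n
  -- Since `n ≤ 2 ^ L`, all coordinates lie in block `0` and share one parameter.
  set q := MvPolynomial.aeval (fun j : Fin n => mergeCurve ε (k * e) (seed ε Q i) L j) f with hq
  have heval : ∀ x : F, q.eval x = f.eval (fun j : Fin n =>
      (mergeCurve ε (k * e) (seed ε Q i) L j).eval x) := by
    intro x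
    rw [hq, MvPolynomial.eval_aeval_polynomial]
  have hq0 : q ≠ 0 := by
    intro h0
    apply hz
    have := heval (z 0)
    rw [h0, Polynomial.eval_zero] at this
    rw [this]
    congr 2
    funext j
    rw [Nat.div_eq_of_lt (j.isLt.trans_le hnL)]
  have hqd : q.natDegree ≤ d * e * (k * e * (k * e)) := by
    obtain ⟨Φ, hm, he, hd, rfl⟩ := hf
    exact MvPolynomial.aeval_natDegree_le _ (Φ.totalDegree_toPoly_le d e hm he hd) _
      fun j => natDegree_mergeCurve_le hr hinj _ _ _
  obtain ⟨s, hs, hsB⟩ := hε.exists_lt_notMem hT q.roots.toFinset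
    (((Multiset.toFinset_card_le _).trans ((Polynomial.card_roots' _).trans hqd)).trans_lt hdeT)
  refine ⟨i + s * Q ^ L, ?_, ?_⟩
  · calc i + s * Q ^ L < Q ^ L + s * Q ^ L := by omega
      _ = (s + 1) * Q ^ L := by ring
      _ ≤ Q * Q ^ L := Nat.mul_le_mul_right _ (by omega)
      _ = Q ^ (L + 1) := by ring
  · rw [seed_add_mul_pow_self ε hi (by omega)]
    have h1 : q.eval (ε s) ≠ 0 := by
      intro h
      exact hsB (by simp [hq0, h])
    rw [heval] at h1
    convert h1 using 3
    funext j
    rw [mergeCurve_congr ε (k * e) fun l' hl' => seed_add_mul_pow_of_lt ε (by omega) i s hl']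

end Generator

/-! ## A program for the points of the hitting set -/

namespace AlgRAM

/-! ### Rules for time-bounded execution. -/

section Rules

variable {F : Type*} [Field F] {ε : ℕ → F}

/-- Started in state `s`, the program halts within `τ` steps in a state with property `P`. -/
def Runs (ε : ℕ → F) (p : Prog) (s : State F) (τ : ℕ) (P : State F → Prop) : Prop :=
  ∃ t ≤ τ, ∃ s', Exec ε p s t s' ∧ P s'

theorem Runs.mono {p : Prog} {s : State F} {τ τ' : ℕ} {P P' : State F → Prop}
    (h : Runs ε p s τ P) (hτ : τ ≤ τ') (hP : ∀ s', P s' → P' s') : Runs ε p s τ' P' := by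
  obtain ⟨t, ht, s', hs, hp⟩ := h
  exact ⟨t, ht.trans hτ, s', hs, hP _ hp⟩

theorem Runs.seq {p q : Prog} {s : State F} {τ τ' : ℕ} {P P' : State F → Prop}
    (h : Runs ε p s τ P) (h' : ∀ s', P s' → Runs ε q s' τ' P') :
    Runs ε (.seq p q) s (τ + τ') P' := by
  obtain ⟨t, ht, s', hs, hp⟩ := h
  obtain ⟨t', ht', s'', hs', hp'⟩ := h' s' hp
  exact ⟨t + t', add_le_add ht ht', s'', .seq _ _ _ _ _ _ _ hs hs', hp'⟩

theorem Runs.setNat {a : ℕ} {i v : NatExpr} {s : State F} {τ : ℕ} {P : State F → Prop}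
    (hc : i.cost s + v.cost s + 1 + (i.eval s).size + (v.eval s).size ≤ τ)
    (h : P (s.writeNat a (i.eval s) (v.eval s))) : Runs ε (.setNat a i v) s τ P :=
  ⟨_, hc, _, .setNat _ _ _ _, h⟩

theorem Runs.setField {a : ℕ} {i : NatExpr} {v : FieldExpr} {s : State F} {τ : ℕ}
    {P : State F → Prop} (hc : i.cost s + v.cost s + 1 + (i.eval s).size ≤ τ)
    (h : P (s.writeField a (i.eval s) (v.eval ε s))) : Runs ε (.setField a i v) s τ P :=
  ⟨_, hc, _, .setField _ _ _ _, h⟩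

theorem Runs.setNat_seq {a : ℕ} {i v : NatExpr} {q : Prog} {s : State F} {τ τ' : ℕ}
    {P : State F → Prop}
    (hc : i.cost s + v.cost s + 1 + (i.eval s).size + (v.eval s).size ≤ τ)
    (h : Runs ε q (s.writeNat a (i.eval s) (v.eval s)) τ' P) :
    Runs ε (.seq (.setNat a i v) q) s (τ + τ') P :=
  Runs.seq (P := fun s' => s' = s.writeNat a (i.eval s) (v.eval s)) (Runs.setNat hc rfl)
    fun _ hs => hs ▸ h

theorem Runs.setField_seq {a : ℕ} {i : NatExpr} {v : FieldExpr} {q : Prog} {s : State F}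
    {τ τ' : ℕ} {P : State F → Prop} (hc : i.cost s + v.cost s + 1 + (i.eval s).size ≤ τ)
    (h : Runs ε q (s.writeField a (i.eval s) (v.eval ε s)) τ' P) :
    Runs ε (.seq (.setField a i v) q) s (τ + τ') P :=
  Runs.seq (P := fun s' => s' = s.writeField a (i.eval s) (v.eval ε s)) (Runs.setField hc rfl)
    fun _ hs => hs ▸ h

theorem Runs.ite {b : Test} {p q : Prog} {s : State F} {τ τ' : ℕ} {P : State F → Prop}
    (hc : b.cost s + 1 ≤ τ) (hp : b.holds ε s → Runs ε p s τ' P)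
    (hq : ¬ b.holds ε s → Runs ε q s τ' P) : Runs ε (.ite b p q) s (τ + τ') P := by
  by_cases hb : b.holds ε s
  · obtain ⟨t, ht, s', hs, h⟩ := hp hb
    exact ⟨_, add_le_add hc ht, s', .iteTrue _ _ _ _ _ _ hb hs, h⟩
  · obtain ⟨t, ht, s', hs, h⟩ := hq hb
    exact ⟨_, add_le_add hc ht, s', .iteFalse _ _ _ _ _ _ hb hs, h⟩

/-- The number `N` of rounds is known, so induction runs over the rounds left. The extra `τ'` pays
for the final failing test. -/
theorem Runs.loop (I : ℕ → State F → Prop) (N : ℕ) {b : Test} {p : Prog} {τb τ τ' : ℕ}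
    (hbody : ∀ x < N, ∀ s, I x s → b.holds ε s ∧ b.cost s ≤ τb ∧ Runs ε p s τ (I (x + 1)))
    (hend : ∀ s, I N s → ¬ b.holds ε s ∧ b.cost s ≤ τb) {s : State F} (hs : I 0 s)
    (hτ : τb + 1 + τ ≤ τ') : Runs ε (.loop b p) s ((N + 1) * τ') (I N) := by
  suffices h : ∀ m x, x + m = N → ∀ s, I x s →
      Runs ε (.loop b p) s ((m + 1) * τ') (I N) from h N 0 (by omega) s hs
  intro m
  induction m with
  | zero =>
    intro x hx s hs
    obtain rfl : x = N := by omega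
    obtain ⟨hb, hc⟩ := hend s hs
    exact ⟨_, by rw [zero_add, one_mul]; omega, s, .loopFalse _ _ _ hb, hs⟩
  | succ m ih =>
    intro x hx s hs
    obtain ⟨hb, hc, t, ht, s', hs', hI⟩ := hbody x (by omega) s hs
    obtain ⟨t', ht', s'', hs'', hI'⟩ := ih (x + 1) (by omega) s' hI
    refine ⟨_, ?_, s'', .loopTrue _ _ _ _ _ _ _ hb hs' hs'', hI'⟩
    rw [Nat.succ_mul]
    omega

/-- A register holding a natural number. -/
def reg (a : ℕ) : NatExpr := .get a (.const 0)

/-- A register holding a field element. -/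
def freg (a : ℕ) : FieldExpr := .get a (.const 0)

omit [Field F] in
theorem eval_reg (s : State F) (a : ℕ) : (reg a).eval s = s.nat a 0 := rfl

omit [Field F] in
theorem cost_reg (s : State F) (a : ℕ) : (reg a).cost s = 2 + (s.nat a 0).size := by
  simp [reg, NatExpr.cost, NatExpr.eval]

theorem eval_freg (s : State F) (a : ℕ) : (freg a).eval ε s = s.fld a 0 := rfl

omit [Field F] in
theorem cost_freg (s : State F) (a : ℕ) : (freg a).cost s = 2 := by
  simp [freg, FieldExpr.cost, NatExpr.cost, NatExpr.eval]

end Rules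

/-! ### The loops of the program, innermost first. -/

/-- Multiply field register `4` by the value at field register `3` of the `m`-th Lagrange basis
polynomial, where `m` is in register `8` and the number of nodes in register `2`. -/
def lagrangeLoop : Prog :=
  .loop (.natLt (reg 9) (reg 2)) <|
    .seq
      (.ite (.natEq (reg 9) (reg 8)) .skip
        (.setField 4 (.const 0) (.mul (freg 4)
          (.mul (.inv (.sub (.elem (reg 8)) (.elem (reg 9)))) (.sub (freg 3) (.elem (reg 9)))))))
      (.setNat 9 (.const 0) (.add (reg 9) (.const 1)))

/-- Add to field register `5` the value at field register `3` of the interpolation polynomial. -/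
def interpolateLoop : Prog :=
  .loop (.natLt (reg 8) (reg 2)) <|
    .seq
      (.ite (.natEq (.mod (.div (reg 4) (reg 6)) (.const 2)) (.const 1))
        (.setField 4 (.const 0)
          (.get 1 (.add (.mul (reg 6) (reg 1)) (.mod (reg 8) (reg 1)))))
        (.setField 4 (.const 0)
          (.get 1 (.add (.mul (reg 6) (reg 1)) (.div (reg 8) (reg 1)))))) <|
    .seq (.setNat 9 (.const 0) (.const 0)) <|
    .seq lagrangeLoop <|
    .seq (.setField 5 (.const 0) (.add (freg 5) (freg 4)))
      (.setNat 8 (.const 0) (.add (reg 8) (.const 1)))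

/-- Tabulate the values of the next curve at the powers of field register `2`. -/
def mergeLoop : Prog :=
  .loop (.natLt (reg 7) (reg 1)) <|
    .seq (.setField 5 (.const 0) .zero) <|
    .seq (.setNat 8 (.const 0) (.const 0)) <|
    .seq interpolateLoop <|
    .seq (.setField 1 (.add (.mul (.mul (.const 2) (reg 6)) (reg 1)) (reg 7)) (freg 5)) <|
    .seq (.setField 3 (.const 0) (.mul (freg 3) (freg 2)))
      (.setNat 7 (.const 0) (.add (reg 7) (.const 1)))

/-- Tabulate the powers of field register `2`. -/
def powerLoop : Prog :=
  .loop (.natLt (reg 7) (reg 1)) <|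
    .seq (.setField 1 (.add (.mul (reg 6) (reg 1)) (reg 7)) (freg 3)) <|
    .seq (.setField 3 (.const 0) (.mul (freg 3) (freg 2)))
      (.setNat 7 (.const 0) (.add (reg 7) (.const 1)))

/-- Read the next digit of the index. -/
def nextSeed (q : Prog) : Prog :=
  .seq (.setField 2 (.const 0) (.elem (.mod (reg 5) (reg 3)))) <|
  .seq (.setNat 5 (.const 0) (.div (reg 5) (reg 3))) <|
  .seq (.setField 3 (.const 0) (freg 2)) <|
  .seq (.setNat 7 (.const 0) (.const 0)) q

/-- Run through the levels of the generator. -/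
def levelLoop : Prog :=
  .loop (.natLt (reg 6) (reg 0)) <|
    nextSeed <|
    .seq mergeLoop (.setNat 6 (.const 0) (.mul (.const 2) (reg 6)))

/-- Run through the coordinates of the point. -/
def coordLoop : Prog :=
  .loop (.natLt (reg 4) (reg 0)) <|
    .seq (.setNat 5 (.const 0) (.get 0 (.const 4))) <|
    .seq (.setNat 6 (.const 0) (.const 1)) <|
    nextSeed <|
    .seq powerLoop <|
    .seq levelLoop <|
    .seq (.setField 0 (reg 4) (.get 1 (.mul (reg 6) (reg 1))))
      (.setNat 4 (.const 0) (.add (reg 4) (.const 1)))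

/-- The program computing the points of the hitting set. -/
def hittingSetProg : Prog :=
  .seq (.setNat 1 (.const 0) (.mul (.get 0 (.const 1)) (.get 0 (.const 2)))) <|
  .seq (.setNat 2 (.const 0) (.mul (reg 1) (reg 1))) <|
  .seq (.setNat 3 (.const 0)
    (.mul (.mul (.mul (.mul (.const 8) (.mul (reg 0) (.mul (.get 0 (.const 3))
      (.get 0 (.const 3))))) (.mul (reg 2) (reg 2))) (.get 0 (.const 2))) (.get 0 (.const 2))))
  coordLoop

/-! ### Correctness and running time of the loops. -/

section Correctness

variable {F : Type*} [Field F] {ε : ℕ → F} {Z : ℕ}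

theorem size_le_of_le {x y : ℕ} (h : x ≤ y) (hy : y.size ≤ Z) : x.size ≤ Z :=
  (Nat.size_le_size h).trans hy

/-- Throughout, `Z` bounds the bit lengths of the numbers involved, so a simple instruction or test
costs at most `40 * (Z + 1)`. Here `161` covers a test (`40`), a body (`120`) and the extra step. -/
theorem runs_lagrangeLoop {s : State F} {m R : ℕ} (hm : s.nat 8 0 = m) (hR : s.nat 2 0 = R)
    (h9 : s.nat 9 0 = 0) (hmR : m < R) (hZ : R.size ≤ Z) :
    Runs ε lagrangeLoop s ((R + 1) * (161 * (Z + 1))) fun s' =>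
      (∀ x ≠ 9, s'.nat x = s.nat x) ∧ (∀ x ≠ 4, s'.fld x = s.fld x) ∧
      s'.fld 4 0 = s.fld 4 0 * (Lagrange.basis (Finset.range R) ε m).eval (s.fld 3 0) := by
  have hbasis : (Lagrange.basis (Finset.range R) ε m).eval (s.fld 3 0) =
      ∏ x ∈ Finset.range R, if x = m then 1 else (ε m - ε x)⁻¹ * (s.fld 3 0 - ε x) := by
    rw [Lagrange.basis, Polynomial.eval_prod, ← Finset.prod_erase (Finset.range R) (a := m)
      (by simp)]
    refine Finset.prod_congr rfl fun x hx => ?_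
    rw [if_neg (Finset.ne_of_mem_erase hx), Lagrange.basisDivisor]
    simp
  rw [hbasis]
  have hmZ : m.size ≤ Z := size_le_of_le hmR.le hZ
  have s1 : Nat.size 1 = 1 := by simp
  refine Runs.mono (Runs.loop (τb := 40 * (Z + 1)) (τ := 120 * (Z + 1)) (fun h s' => s'.nat 9 0 = h ∧
    (∀ x ≠ 9, s'.nat x = s.nat x) ∧ (∀ x ≠ 4, s'.fld x = s.fld x) ∧
    s'.fld 4 0 = s.fld 4 0 * ∏ x ∈ Finset.range h,
      if x = m then 1 else (ε m - ε x)⁻¹ * (s.fld 3 0 - ε x)) R ?_ ?_ ?_ ?_) le_rfl ?_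
  · rintro h hh s' ⟨h9', hn, hf, h4⟩
    have hhZ : h.size ≤ Z := size_le_of_le hh.le hZ
    have hhZ' : (h + 1).size ≤ Z := size_le_of_le hh hZ
    refine ⟨?_, ?_, ?_⟩
    · simp [Test.holds, eval_reg, h9', hn, hR, hh]
    · simp [Test.cost, eval_reg, cost_reg, h9', hn, hR]
      omega
    · refine Runs.mono (Runs.seq (τ := 80 * (Z + 1)) (τ' := 40 * (Z + 1)) (P := fun s'' =>
        s''.nat = s'.nat ∧ (∀ x ≠ 4, s''.fld x = s.fld x) ∧
        s''.fld 4 0 = s.fld 4 0 * ∏ x ∈ Finset.range (h + 1),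
          if x = m then 1 else (ε m - ε x)⁻¹ * (s.fld 3 0 - ε x)) ?_ ?_) (by omega)
          (fun _ h => h)
      · refine Runs.mono (Runs.ite (τ := 40 * (Z + 1)) (τ' := 40 * (Z + 1)) ?_ ?_ ?_) (by omega)
          (fun _ h => h)
        · simp [Test.cost, eval_reg, cost_reg, h9', hn, hm]
          omega
        · intro hb
          simp only [Test.holds, eval_reg, h9'] at hb
          rw [hn 8 (by decide), hm] at hb
          refine ⟨1, by omega, s', .skip _, rfl, hf, ?_⟩
          rw [Finset.prod_range_succ, if_pos hb, mul_one, h4]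
        · intro hb
          simp only [Test.holds, eval_reg, h9'] at hb
          rw [hn 8 (by decide), hm] at hb
          refine Runs.setField ?_ ⟨rfl, ?_, ?_⟩
          · simp [FieldExpr.cost, NatExpr.cost, NatExpr.eval, eval_reg, cost_reg, cost_freg,
              h9', hn, hm]
            omega
          · intro x hx
            simp [State.writeField, hx, hf]
          · simp only [State.writeField, NatExpr.eval, FieldExpr.eval, eval_freg, eval_reg,
              Function.update_self, h9']
            rw [Finset.prod_range_succ, if_neg hb, hn 8 (by decide), hm, h4, hf 3 (by decide)]
            ring
      · rintro s'' ⟨hn', hf', h4'⟩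
        refine Runs.setNat ?_ ⟨?_, ?_, hf', h4'⟩
        · simp [NatExpr.cost, NatExpr.eval, eval_reg, cost_reg, h9', hn']
          omega
        · simp [State.writeNat, NatExpr.eval, eval_reg, h9', hn']
        · intro x hx
          simp [State.writeNat, hx, hn', hn]
  · rintro s' ⟨h9', hn, -, -⟩
    refine ⟨?_, ?_⟩
    · simp [Test.holds, eval_reg, h9', hn, hR]
    · simp [Test.cost, eval_reg, cost_reg, h9', hn, hR]
      omega
  · simp [h9]
  · omega
  · rintro s' ⟨-, h⟩
    exact h

theorem runs_interpolateLoop {s : State F} {r j p : ℕ} (h1 : s.nat 1 0 = r)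
    (h2 : s.nat 2 0 = r * r) (h4 : s.nat 4 0 = j) (h6 : s.nat 6 0 = p) (h8 : s.nat 8 0 = 0)
    (hf5 : s.fld 5 0 = 0) (hZ : 2 ≤ Z) (hr : r.size ≤ Z) (hR : (r * r).size ≤ Z)
    (hj : j.size ≤ Z) (hp : p.size ≤ Z) (hpr : (p * r + r).size ≤ Z) :
    Runs ε interpolateLoop s
      ((r * r + 1) * (400 * (Z + 1) + (r * r + 1) * (161 * (Z + 1)))) fun s' =>
      (∀ x, x ≠ 8 → x ≠ 9 → s'.nat x = s.nat x) ∧ (∀ x, x ≠ 4 → x ≠ 5 → s'.fld x = s.fld x) ∧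
      s'.fld 5 0 = (Lagrange.interpolate (Finset.range (r * r)) ε fun m =>
        s.fld 1 (p * r + if j / p % 2 = 1 then m % r else m / r)).eval (s.fld 3 0) := by
  set T : ℕ → F := fun m => s.fld 1 (p * r + if j / p % 2 = 1 then m % r else m / r) with hT
  set b : ℕ → F := fun m => (Lagrange.basis (Finset.range (r * r)) ε m).eval (s.fld 3 0) with hb
  have hinterp : (Lagrange.interpolate (Finset.range (r * r)) ε T).eval (s.fld 3 0) =
      ∑ x ∈ Finset.range (r * r), T x * b x := by
    simp [Lagrange.interpolate_apply, Polynomial.eval_finsetSum, hb]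
  rw [hinterp]
  have s1 : Nat.size 1 = 1 := by simp
  have s2 : Nat.size 2 = 2 := by decide
  refine Runs.mono (Runs.loop (τb := 40 * (Z + 1))
    (τ := 300 * (Z + 1) + (r * r + 1) * (161 * (Z + 1)))
    (τ' := 400 * (Z + 1) + (r * r + 1) * (161 * (Z + 1))) (fun h s' => s'.nat 8 0 = h ∧
    (∀ x, x ≠ 8 → x ≠ 9 → s'.nat x = s.nat x) ∧ (∀ x, x ≠ 4 → x ≠ 5 → s'.fld x = s.fld x) ∧
    s'.fld 5 0 = ∑ x ∈ Finset.range h, T x * b x) (r * r) ?_ ?_ ?_ ?_) le_rfl ?_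
  · rintro h hh s' ⟨h8', hn, hf, h5⟩
    have hrpos : 0 < r := Nat.pos_of_ne_zero (by rintro rfl; simp at hh)
    have hhZ : h.size ≤ Z := size_le_of_le hh.le hR
    have hhZ' : (h + 1).size ≤ Z := size_le_of_le hh hR
    have q1 : (j / p).size ≤ Z := size_le_of_le (Nat.div_le_self _ _) hj
    have q2 : (j / p % 2).size ≤ Z := size_le_of_le (Nat.mod_le _ _) q1
    have q3 : (h % r).size ≤ Z := size_le_of_le (Nat.mod_le _ _) hhZ
    have q4 : (h / r).size ≤ Z := size_le_of_le (Nat.div_le_self _ _) hhZ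
    have q5 : (p * r).size ≤ Z := size_le_of_le (Nat.le_add_right _ _) hpr
    have q6 : (p * r + h % r).size ≤ Z :=
      size_le_of_le (Nat.add_le_add_left (Nat.mod_lt _ hrpos).le _) hpr
    have q7 : (p * r + h / r).size ≤ Z :=
      size_le_of_le (Nat.add_le_add_left (Nat.div_lt_of_lt_mul hh).le _) hpr
    refine ⟨?_, ?_, ?_⟩
    · simp [Test.holds, eval_reg, h8', hn, h2, hh]
    · simp [Test.cost, eval_reg, cost_reg, h8', hn, h2]
      omega
    · refine Runs.mono (Runs.seq (τ := 40 * (Z + 1) + 40 * (Z + 1)) (P := fun s'' =>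
        s''.nat = s'.nat ∧ (∀ x, x ≠ 4 → s''.fld x = s'.fld x) ∧ s''.fld 4 0 = T h)
        (Runs.ite ?_ ?_ ?_) fun s'' hs'' => Runs.setNat_seq (τ := 40 * (Z + 1)) ?_
        (Runs.seq (runs_lagrangeLoop (m := h) (R := r * r) (Z := Z) ?_ ?_ ?_ hh hR)
        fun s₃ hs₃ => Runs.setField_seq (τ := 40 * (Z + 1)) ?_
        (Runs.setNat (τ := 40 * (Z + 1)) ?_ ?_))) (by omega) (fun _ h => h)
      · simp [Test.cost, NatExpr.cost, NatExpr.eval, eval_reg, cost_reg, hn, h4, h6, s2]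
        omega
      · intro hb
        simp only [Test.holds, NatExpr.eval, eval_reg] at hb
        rw [hn 4 (by decide) (by decide), hn 6 (by decide) (by decide), h4, h6] at hb
        refine Runs.setField ?_ ⟨rfl, ?_, ?_⟩
        · simp [FieldExpr.cost, NatExpr.cost, NatExpr.eval, eval_reg, cost_reg, hn, h1, h6, h8']
          omega
        · intro x hx
          simp [State.writeField, hx]
        · simp [State.writeField, NatExpr.eval, FieldExpr.eval, eval_reg, hn, h1, h6, h8', hf, hT,
            hb]
      · intro hb
        simp only [Test.holds, NatExpr.eval, eval_reg] at hb
        rw [hn 4 (by decide) (by decide), hn 6 (by decide) (by decide), h4, h6] at hb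
        refine Runs.setField ?_ ⟨rfl, ?_, ?_⟩
        · simp [FieldExpr.cost, NatExpr.cost, NatExpr.eval, eval_reg, cost_reg, hn, h1, h6, h8']
          omega
        · intro x hx
          simp [State.writeField, hx]
        · simp only [State.writeField, NatExpr.eval, FieldExpr.eval, eval_reg,
            Function.update_self, hT, if_neg hb]
          simp [hn, h1, h6, h8', hf]
      · simp [NatExpr.cost, NatExpr.eval]
        omega
      · simp [State.writeNat, NatExpr.eval, hs''.1, h8']
      · simp [State.writeNat, NatExpr.eval, hs''.1, hn, h2]
      · simp [State.writeNat, NatExpr.eval]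
      · simp [FieldExpr.cost, NatExpr.cost, NatExpr.eval, cost_freg]
        omega
      · have e8 : s₃.nat 8 0 = h := by
          rw [hs₃.1 8 (by decide)]
          simp [State.writeNat, hs''.1, h8']
        simp [State.writeField, NatExpr.cost, NatExpr.eval, eval_reg, cost_reg, e8]
        omega
      · obtain ⟨hn'', hf'', h4''⟩ := hs''
        obtain ⟨hn₃, hf₃, h4₃⟩ := hs₃
        have e8 : s₃.nat 8 0 = h := by
          rw [hn₃ 8 (by decide)]
          simp [State.writeNat, hn'', h8']
        have e5 : s₃.fld 5 0 = s'.fld 5 0 := by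
          rw [hf₃ 5 (by decide)]
          simp [State.writeNat, hf'']
        have e4 : s₃.fld 4 0 = T h * b h := by
          rw [h4₃]
          simp [State.writeNat, h4'', hf'', hf, hb]
        refine ⟨?_, ?_, ?_, ?_⟩
        · simp [State.writeNat, State.writeField, NatExpr.eval, eval_reg, e8]
        · intro x hx hx'
          simp [State.writeNat, State.writeField, hx, hx', hn₃, hn'', hn]
        · intro x hx hx'
          simp [State.writeNat, State.writeField, hx, hx', hf₃, hf'', hf]
        · rw [Finset.sum_range_succ, ← h5, ← e4, ← e5]
          simp [State.writeNat, State.writeField, NatExpr.eval, FieldExpr.eval, eval_freg]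
  · rintro s' ⟨h8', hn, -, -⟩
    refine ⟨?_, ?_⟩
    · simp [Test.holds, eval_reg, h8', hn, h2]
    · simp [Test.cost, eval_reg, cost_reg, h8', hn, h2]
      omega
  · simp [h8, hf5]
  · omega
  · rintro s' ⟨-, h⟩
    exact h

/-- The running time of `mergeLoop`. -/
def mergeTime (r Z : ℕ) : ℕ :=
  (r + 1) * (500 * (Z + 1) +
    (r * r + 1) * (400 * (Z + 1) + (r * r + 1) * (161 * (Z + 1))))

/-- The old table starts at `p * r` and the new one at `2 * p * r`; as `p > 0` they are disjoint, so
the old values survive while the new ones are written. -/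
theorem runs_mergeLoop {s : State F} {r j p : ℕ} {α : F} (h1 : s.nat 1 0 = r)
    (h2 : s.nat 2 0 = r * r) (h4 : s.nat 4 0 = j) (h6 : s.nat 6 0 = p) (h7 : s.nat 7 0 = 0)
    (hf2 : s.fld 2 0 = α) (hf3 : s.fld 3 0 = α) (hp0 : 0 < p) (hZ : 2 ≤ Z)
    (hR : (r * r).size ≤ Z) (hj : j.size ≤ Z) (hp : (2 * p).size ≤ Z)
    (hpr : (2 * p * r + r).size ≤ Z) :
    Runs ε mergeLoop s (mergeTime r Z) fun s' =>
      (∀ x, x ≠ 7 → x ≠ 8 → x ≠ 9 → s'.nat x = s.nat x) ∧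
      (∀ x, x ≠ 1 → x ≠ 3 → x ≠ 4 → x ≠ 5 → s'.fld x = s.fld x) ∧
      ∀ a < r, s'.fld 1 (2 * p * r + a) =
        (Lagrange.interpolate (Finset.range (r * r)) ε fun m =>
          s.fld 1 (p * r + if j / p % 2 = 1 then m % r else m / r)).eval (α ^ (a + 1)) := by
  have s2 : Nat.size 2 = 2 := by decide
  have hr : r.size ≤ Z := size_le_of_le (Nat.le_add_left _ _) hpr
  have hp' : p.size ≤ Z := size_le_of_le (by omega) hp
  have hpr1 : (2 * p * r).size ≤ Z := size_le_of_le (Nat.le_add_right _ _) hpr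
  have hpr2 : (p * r + r).size ≤ Z := size_le_of_le (by nlinarith) hpr
  refine Runs.mono (Runs.loop (τb := 40 * (Z + 1))
    (τ := 400 * (Z + 1) + (r * r + 1) * (400 * (Z + 1) + (r * r + 1) * (161 * (Z + 1))))
    (τ' := 500 * (Z + 1) + (r * r + 1) * (400 * (Z + 1) + (r * r + 1) * (161 * (Z + 1))))
    (fun h s' => s'.nat 7 0 = h ∧
      (∀ x, x ≠ 7 → x ≠ 8 → x ≠ 9 → s'.nat x = s.nat x) ∧
      (∀ x, x ≠ 1 → x ≠ 3 → x ≠ 4 → x ≠ 5 → s'.fld x = s.fld x) ∧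
      s'.fld 3 0 = α ^ (h + 1) ∧ (∀ x < 2 * p * r, s'.fld 1 x = s.fld 1 x) ∧
      ∀ a < h, s'.fld 1 (2 * p * r + a) =
        (Lagrange.interpolate (Finset.range (r * r)) ε fun m =>
          s.fld 1 (p * r + if j / p % 2 = 1 then m % r else m / r)).eval (α ^ (a + 1)))
    r ?_ ?_ ?_ ?_) le_rfl ?_
  · rintro h hh s' ⟨h7', hn, hf, hw, hold, hnew⟩
    have hhZ : h.size ≤ Z := size_le_of_le hh.le hr
    have hhZ' : (h + 1).size ≤ Z := size_le_of_le hh hr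
    have q1 : (2 * p * r + h).size ≤ Z := size_le_of_le (by omega) hpr
    refine ⟨?_, ?_, ?_⟩
    · simp [Test.holds, eval_reg, h7', hn, h1, hh]
    · simp [Test.cost, eval_reg, cost_reg, h7', hn, h1]
      omega
    · refine Runs.mono (Runs.setField_seq (τ := 40 * (Z + 1)) ?_ <|
        Runs.setNat_seq (τ := 40 * (Z + 1)) ?_ <|
        Runs.seq (runs_interpolateLoop (Z := Z) (r := r) (j := j) (p := p) ?_ ?_ ?_ ?_ ?_ ?_ hZ hr
          hR hj hp' hpr2)
        fun s₃ hs₃ => Runs.setField_seq (τ := 40 * (Z + 1)) ?_ <|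
        Runs.setField_seq (τ := 40 * (Z + 1)) ?_ <|
        Runs.setNat (τ := 40 * (Z + 1)) ?_ ?_) (by omega) (fun _ h => h)
      · simp [FieldExpr.cost, NatExpr.cost, NatExpr.eval]
        omega
      · simp [NatExpr.cost, NatExpr.eval]
        omega
      · simp [State.writeNat, State.writeField, hn, h1]
      · simp [State.writeNat, State.writeField, hn, h2]
      · simp [State.writeNat, State.writeField, hn, h4]
      · simp [State.writeNat, State.writeField, hn, h6]
      · simp [State.writeNat, NatExpr.eval]
      · simp [State.writeNat, State.writeField, NatExpr.eval, FieldExpr.eval]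
      all_goals
        obtain ⟨hn₃, hf₃, h5₃⟩ := hs₃
        have e1 : s₃.nat 1 0 = r := by
          rw [hn₃ 1 (by decide) (by decide)]; simp [State.writeNat, State.writeField, hn, h1]
        have e6 : s₃.nat 6 0 = p := by
          rw [hn₃ 6 (by decide) (by decide)]; simp [State.writeNat, State.writeField, hn, h6]
        have e7 : s₃.nat 7 0 = h := by
          rw [hn₃ 7 (by decide) (by decide)]; simp [State.writeNat, State.writeField, h7']
      · simp [NatExpr.cost, NatExpr.eval, cost_freg, eval_reg, cost_reg, e1, e6, e7, s2]
        omega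
      · simp [FieldExpr.cost, NatExpr.cost, NatExpr.eval, cost_freg]
        omega
      · simp [State.writeField, NatExpr.cost, NatExpr.eval, eval_reg, cost_reg, e7]
        omega
      · have g2 : s₃.fld 2 0 = α := by
          rw [hf₃ 2 (by decide) (by decide)]; simp [State.writeNat, State.writeField, hf, hf2]
        have g3 : s₃.fld 3 0 = α ^ (h + 1) := by
          rw [hf₃ 3 (by decide) (by decide)]; simp [State.writeNat, State.writeField, hw]
        have g1 : s₃.fld 1 = s'.fld 1 := by
          rw [hf₃ 1 (by decide) (by decide)]; simp [State.writeNat, State.writeField]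
        have g5 : s₃.fld 5 0 = (Lagrange.interpolate (Finset.range (r * r)) ε fun m =>
            s.fld 1 (p * r + if j / p % 2 = 1 then m % r else m / r)).eval (α ^ (h + 1)) := by
          rw [h5₃]
          rw [show ∀ t : State F, ∀ v, (t.writeNat 8 (NatExpr.eval t (.const 0)) v).fld 3 0 =
            t.fld 3 0 from fun _ _ => rfl]
          rw [show ∀ t : State F, ∀ v w, (t.writeField 5 v w).fld 3 0 =
            t.fld 3 0 from fun _ _ _ => by simp [State.writeField], hw]
          congr 1
          refine Lagrange.interpolate_eq_of_values_eq_on _ _ fun m hm => ?_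
          have hm' := Finset.mem_range.1 hm
          have : (if j / p % 2 = 1 then m % r else m / r) < r := by
            split_ifs
            · exact Nat.mod_lt _ (by omega)
            · exact Nat.div_lt_of_lt_mul hm'
          -- The cell read lies in the old table, which the loop has not overwritten.
          have hlt : p * r + (if j / p % 2 = 1 then m % r else m / r) < 2 * p * r := by nlinarith
          simpa [State.writeNat, State.writeField] using hold _ hlt
        refine ⟨?_, ?_, ?_, ?_, ?_, ?_⟩
        · simp [State.writeNat, State.writeField, NatExpr.eval, eval_reg, e7]
        · intro x hx hx' hx''
          simp [State.writeNat, State.writeField, hx, hx', hx'', hn₃, hn]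
        · intro x hx hx' hx'' hx'''
          simp [State.writeNat, State.writeField, hx, hx', hx'', hx''', hf₃, hf]
        · simp [State.writeNat, State.writeField, NatExpr.eval, FieldExpr.eval, eval_freg, g2, g3,
            pow_succ]
        · intro x hx
          have : x ≠ 2 * p * r + h := by omega
          simp [State.writeNat, State.writeField, NatExpr.eval, eval_reg, e1, e6, e7, this, g1,
            hold x hx]
        · intro a ha
          by_cases hah : a = h
          · subst hah
            simp [State.writeNat, State.writeField, NatExpr.eval, eval_reg, eval_freg, e1, e6, e7,
              g5]
          · rw [← hnew a (by omega)]
            simp [State.writeNat, State.writeField, NatExpr.eval, eval_reg, e1, e6, e7, g1, hah]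
  · rintro s' ⟨h7', hn, -⟩
    refine ⟨?_, ?_⟩
    · simp [Test.holds, eval_reg, h7', hn, h1]
    · simp [Test.cost, eval_reg, cost_reg, h7', hn, h1]
      omega
  · simp [h7, hf3]
  · omega
  · rintro s' ⟨-, h, h', -, -, h''⟩
    exact ⟨h, h', h''⟩

theorem runs_powerLoop {s : State F} {r p : ℕ} {α : F} (h1 : s.nat 1 0 = r)
    (h6 : s.nat 6 0 = p) (h7 : s.nat 7 0 = 0) (hf2 : s.fld 2 0 = α) (hf3 : s.fld 3 0 = α)
    (hp : p.size ≤ Z) (hpr : (p * r + r).size ≤ Z) :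
    Runs ε powerLoop s ((r + 1) * (200 * (Z + 1))) fun s' =>
      (∀ x, x ≠ 7 → s'.nat x = s.nat x) ∧
      (∀ x, x ≠ 1 → x ≠ 3 → s'.fld x = s.fld x) ∧
      ∀ a < r, s'.fld 1 (p * r + a) = α ^ (a + 1) := by
  have hr : r.size ≤ Z := size_le_of_le (Nat.le_add_left _ _) hpr
  have hpr1 : (p * r).size ≤ Z := size_le_of_le (Nat.le_add_right _ _) hpr
  have s1 : Nat.size 1 = 1 := by simp
  refine Runs.mono (Runs.loop (τb := 40 * (Z + 1)) (τ := 120 * (Z + 1)) (τ' := 200 * (Z + 1))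
    (fun h s' => s'.nat 7 0 = h ∧ (∀ x, x ≠ 7 → s'.nat x = s.nat x) ∧
      (∀ x, x ≠ 1 → x ≠ 3 → s'.fld x = s.fld x) ∧ s'.fld 3 0 = α ^ (h + 1) ∧
      ∀ a < h, s'.fld 1 (p * r + a) = α ^ (a + 1)) r ?_ ?_ ?_ ?_) le_rfl ?_
  · rintro h hh s' ⟨h7', hn, hf, hw, hnew⟩
    have hhZ : h.size ≤ Z := size_le_of_le hh.le hr
    have hhZ' : (h + 1).size ≤ Z := size_le_of_le hh hr
    have q1 : (p * r + h).size ≤ Z := size_le_of_le (by omega) hpr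
    refine ⟨?_, ?_, ?_⟩
    · simp [Test.holds, eval_reg, h7', hn, h1, hh]
    · simp [Test.cost, eval_reg, cost_reg, h7', hn, h1]
      omega
    · refine Runs.mono (Runs.setField_seq (τ := 40 * (Z + 1)) ?_ <|
        Runs.setField_seq (τ := 40 * (Z + 1)) ?_ <|
        Runs.setNat (τ := 40 * (Z + 1)) ?_ ?_) (by omega) (fun _ h => h)
      · simp [NatExpr.cost, NatExpr.eval, cost_freg, eval_reg, cost_reg, hn, h1, h6, h7']
        omega
      · simp [FieldExpr.cost, NatExpr.cost, NatExpr.eval, cost_freg]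
        omega
      · simp [State.writeField, NatExpr.cost, NatExpr.eval, eval_reg, cost_reg, h7']
        omega
      · refine ⟨?_, ?_, ?_, ?_, ?_⟩
        · simp [State.writeNat, State.writeField, NatExpr.eval, eval_reg, h7']
        · intro x hx
          simp [State.writeNat, State.writeField, hx, hn]
        · intro x hx hx'
          simp [State.writeNat, State.writeField, hx, hx', hf]
        · simp [State.writeNat, State.writeField, NatExpr.eval, FieldExpr.eval, eval_freg, hf, hf2,
            hw, pow_succ]
        · intro a ha
          by_cases hah : a = h
          · subst hah
            simp [State.writeNat, State.writeField, NatExpr.eval, eval_reg, eval_freg, hn, h1, h6,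
              h7', hw]
          · rw [← hnew a (by omega)]
            simp [State.writeNat, State.writeField, NatExpr.eval, eval_reg, hn, h1, h6, h7', hah]
  · rintro s' ⟨h7', hn, -⟩
    refine ⟨?_, ?_⟩
    · simp [Test.holds, eval_reg, h7', hn, h1]
    · simp [Test.cost, eval_reg, cost_reg, h7', hn, h1]
      omega
  · simp [h7, hf3]
  · omega
  · rintro s' ⟨-, h, h', -, h''⟩
    exact ⟨h, h', h''⟩

theorem runs_nextSeed {q : Prog} {s : State F} {i Q τ : ℕ} {P : State F → Prop}
    (h5 : s.nat 5 0 = i) (h3 : s.nat 3 0 = Q) (hi : i.size ≤ Z) (hQ : Q.size ≤ Z)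
    (hq : ∀ s' : State F, (∀ x, x ≠ 5 → x ≠ 7 → s'.nat x = s.nat x) → s'.nat 5 0 = i / Q →
      s'.nat 7 0 = 0 → (∀ x, x ≠ 2 → x ≠ 3 → s'.fld x = s.fld x) → s'.fld 2 0 = ε (i % Q) →
      s'.fld 3 0 = ε (i % Q) → Runs ε q s' τ P) :
    Runs ε (nextSeed q) s (160 * (Z + 1) + τ) P := by
  have q1 : (i % Q).size ≤ Z := size_le_of_le (Nat.mod_le _ _) hi
  have q2 : (i / Q).size ≤ Z := size_le_of_le (Nat.div_le_self _ _) hi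
  refine Runs.mono (Runs.setField_seq (τ := 40 * (Z + 1)) ?_ <|
    Runs.setNat_seq (τ := 40 * (Z + 1)) ?_ <|
    Runs.setField_seq (τ := 40 * (Z + 1)) ?_ <|
    Runs.setNat_seq (τ := 40 * (Z + 1)) ?_ (hq _ ?_ ?_ ?_ ?_ ?_ ?_)) (by omega) (fun _ h => h)
  · simp [FieldExpr.cost, NatExpr.cost, NatExpr.eval, eval_reg, cost_reg, h3, h5]
    omega
  · simp [State.writeField, NatExpr.cost, NatExpr.eval, eval_reg, cost_reg, h3, h5]
    omega
  · simp [NatExpr.cost, NatExpr.eval, cost_freg]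
    omega
  · simp [NatExpr.cost, NatExpr.eval]
    omega
  · intro x hx hx'
    simp [State.writeNat, State.writeField, hx, hx']
  · simp [State.writeNat, State.writeField, NatExpr.eval, eval_reg, h3, h5]
  · simp [State.writeNat, NatExpr.eval]
  · intro x hx hx'
    simp [State.writeNat, State.writeField, hx, hx']
  · simp [State.writeNat, State.writeField, NatExpr.eval, FieldExpr.eval, eval_reg, h3, h5]
  · simp [State.writeNat, State.writeField, NatExpr.eval, FieldExpr.eval, eval_reg, eval_freg, h3,
      h5]

/-- The running time of `levelLoop`. -/
def levelTime (L r Z : ℕ) : ℕ := (L + 1) * (300 * (Z + 1) + mergeTime r Z)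

/-- Invariant after `l` rounds: register `6` holds `2 ^ l`, register `5` the digits of `i` above
position `l`, and the table at `2 ^ l * r` the level `l` curve at the powers of digit `l`. The last
parameter is thus treated like one more `α`. -/
theorem runs_levelLoop {s : State F} {n r Q i j : ℕ} (h0 : s.nat 0 0 = n) (h1 : s.nat 1 0 = r)
    (h2 : s.nat 2 0 = r * r) (h3 : s.nat 3 0 = Q) (h4 : s.nat 4 0 = j) (h5 : s.nat 5 0 = i / Q)
    (h6 : s.nat 6 0 = 1) (hT : ∀ a < r, s.fld 1 (1 * r + a) = seed ε Q i 0 ^ (a + 1))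
    (hZ : 2 ≤ Z) (hn : n.size ≤ Z) (hR : (r * r).size ≤ Z) (hQ : Q.size ≤ Z) (hi : i.size ≤ Z)
    (hj : j.size ≤ Z) (hL : (2 ^ Nat.clog 2 n).size ≤ Z)
    (hLr : (2 ^ Nat.clog 2 n * r + r).size ≤ Z) :
    Runs ε levelLoop s (levelTime (Nat.clog 2 n) r Z) fun s' =>
      (∀ x, x < 5 → s'.nat x = s.nat x) ∧ s'.fld 0 = s.fld 0 ∧
      s'.nat 6 0 = 2 ^ Nat.clog 2 n ∧
      ∀ a < r, s'.fld 1 (2 ^ Nat.clog 2 n * r + a) =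
        (mergeCurve ε r (seed ε Q i) (Nat.clog 2 n) j).eval
          (seed ε Q i (Nat.clog 2 n) ^ (a + 1)) := by
  have s2 : Nat.size 2 = 2 := by decide
  refine Runs.mono (Runs.loop (τb := 40 * (Z + 1)) (τ := 200 * (Z + 1) + mergeTime r Z)
    (τ' := 300 * (Z + 1) + mergeTime r Z)
    (fun l s' => (∀ x, x < 5 → s'.nat x = s.nat x) ∧ s'.fld 0 = s.fld 0 ∧
      s'.nat 6 0 = 2 ^ l ∧ s'.nat 5 0 = i / Q ^ (l + 1) ∧
      ∀ a < r, s'.fld 1 (2 ^ l * r + a) =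
        (mergeCurve ε r (seed ε Q i) l j).eval (seed ε Q i l ^ (a + 1)))
    (Nat.clog 2 n) ?_ ?_ ?_ ?_) le_rfl ?_
  · rintro l hl s' ⟨hn', hf, h6', h5', hT'⟩
    have hpow : 2 * 2 ^ l ≤ 2 ^ Nat.clog 2 n := by
      rw [← pow_succ']
      exact Nat.pow_le_pow_right (by norm_num) hl
    have p0 : 0 < 2 ^ l := by positivity
    have q1 : (2 * 2 ^ l).size ≤ Z := size_le_of_le hpow hL
    have q2 : (2 * 2 ^ l * r + r).size ≤ Z :=
      size_le_of_le (Nat.add_le_add_right (Nat.mul_le_mul_right _ hpow) _) hLr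
    have q3 : (2 ^ l).size ≤ Z := size_le_of_le (by omega) q1
    have q4 : (i / Q ^ (l + 1)).size ≤ Z := size_le_of_le (Nat.div_le_self _ _) hi
    refine ⟨?_, ?_, ?_⟩
    · simp only [Test.holds, eval_reg, h6', hn' 0 (by decide), h0]
      -- Comparing `2 ^ l` with `n` counts the levels without computing a logarithm.
      exact (Nat.lt_clog_iff_pow_lt (by norm_num)).1 hl
    · simp [Test.cost, eval_reg, cost_reg, h6', hn', h0]
      omega
    · refine Runs.mono (runs_nextSeed (Z := Z) (i := i / Q ^ (l + 1)) (Q := Q)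
        (τ := mergeTime r Z + 40 * (Z + 1)) h5' ((by rw [hn' 3 (by decide), h3])) q4 hQ ?_)
        (by omega) (fun _ h => h)
      intro s₁ hn₁ h5₁ h7₁ hf₁ h2₁ h3₁
      have e6 : s₁.nat 6 0 = 2 ^ l := by rw [hn₁ 6 (by decide) (by decide), h6']
      refine Runs.seq (runs_mergeLoop (Z := Z) (r := r) (j := j) (p := 2 ^ l)
        (α := seed ε Q i (l + 1)) ?_ ?_ ?_ e6 h7₁ h2₁ h3₁ p0 hZ hR hj q1 q2)
        fun s₂ ⟨hn₂, hf₂, hT₂⟩ => Runs.setNat ?_ ⟨?_, ?_, ?_, ?_, ?_⟩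
      · rw [hn₁ 1 (by decide) (by decide), hn' 1 (by decide), h1]
      · rw [hn₁ 2 (by decide) (by decide), hn' 2 (by decide), h2]
      · rw [hn₁ 4 (by decide) (by decide), hn' 4 (by decide), h4]
      · simp [NatExpr.cost, NatExpr.eval, eval_reg, cost_reg, hn₂, e6, s2]
        omega
      · intro x hx
        have : x ≠ 5 ∧ x ≠ 6 ∧ x ≠ 7 ∧ x ≠ 8 ∧ x ≠ 9 := by omega
        simp [State.writeNat, this, hn₂, hn₁, hn' x hx]
      · simp [State.writeNat, hf₂, hf₁, hf]
      · simp [State.writeNat, NatExpr.eval, eval_reg, hn₂, e6, pow_succ']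
      · simp [State.writeNat, NatExpr.eval, hn₂, h5₁, Nat.div_div_eq_div_mul, pow_succ]
      · intro a ha
        have : s₁.fld 1 = s'.fld 1 := hf₁ 1 (by decide) (by decide)
        simp only [State.writeNat]
        rw [pow_succ', hT₂ a ha, mergeCurve, this]
        congr 1
        refine Lagrange.interpolate_eq_of_values_eq_on _ _ fun m hm => ?_
        have hm' := Finset.mem_range.1 hm
        refine hT' _ ?_
        split_ifs
        · exact Nat.mod_lt _ (by omega)
        · exact Nat.div_lt_of_lt_mul hm'
  · rintro s' ⟨hn', -, h6', -⟩
    refine ⟨?_, ?_⟩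
    · simp only [Test.holds, eval_reg, h6', hn' 0 (by decide), h0, not_lt]
      exact Nat.le_pow_clog (by norm_num) n
    · simp [Test.cost, eval_reg, cost_reg, h6', hn', h0]
      omega
  · refine ⟨fun _ _ => rfl, rfl, by simpa using h6, by simpa using h5, fun a ha => ?_⟩
    rw [pow_zero, hT a ha, mergeCurve, Polynomial.eval_X]
  · omega
  · rintro s' ⟨h, h', h'', -, h'''⟩
    exact ⟨h, h', h'', h'''⟩

/-- The running time of `coordLoop`. -/
def coordTime (n r Z : ℕ) : ℕ :=
  (n + 1) * (500 * (Z + 1) + (r + 1) * (200 * (Z + 1)) + levelTime (Nat.clog 2 n) r Z)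

/-- Natural registers `0` to `4` hold `n`, `r`, `r * r`, `Q` and the coordinate. The index is kept
in cell `4` of array `0`, since register `5` is consumed afresh for every coordinate. -/
theorem runs_coordLoop {s : State F} {n r Q i : ℕ} (h0 : s.nat 0 0 = n) (h04 : s.nat 0 4 = i)
    (h1 : s.nat 1 0 = r) (h2 : s.nat 2 0 = r * r) (h3 : s.nat 3 0 = Q) (h4 : s.nat 4 0 = 0)
    (hr : 0 < r) (hZ : 3 ≤ Z) (hn : n.size ≤ Z) (hR : (r * r).size ≤ Z) (hQ : Q.size ≤ Z)
    (hi : i.size ≤ Z) (hL : (2 ^ Nat.clog 2 n).size ≤ Z)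
    (hLr : (2 ^ Nat.clog 2 n * r + r).size ≤ Z) :
    Runs ε coordLoop s (coordTime n r Z) fun s' => ∀ j < n, s'.fld 0 j =
      (mergeCurve ε r (seed ε Q i) (Nat.clog 2 n) j).eval (seed ε Q i (Nat.clog 2 n)) := by
  have s1 : Nat.size 1 = 1 := by simp
  have s4 : Nat.size 4 = 3 := by decide
  have r1 : (1 * r + r).size ≤ Z :=
    size_le_of_le (Nat.add_le_add_right (Nat.mul_le_mul_right _ Nat.one_le_two_pow) _) hLr
  have r2 : r.size ≤ Z := size_le_of_le (Nat.le_add_left _ _) r1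
  have r3 : (2 ^ Nat.clog 2 n * r).size ≤ Z := size_le_of_le (Nat.le_add_right _ _) hLr
  refine Runs.mono (Runs.loop (τb := 40 * (Z + 1))
    (τ := 400 * (Z + 1) + (r + 1) * (200 * (Z + 1)) + levelTime (Nat.clog 2 n) r Z)
    (τ' := 500 * (Z + 1) + (r + 1) * (200 * (Z + 1)) + levelTime (Nat.clog 2 n) r Z)
    (fun h s' => s'.nat 4 0 = h ∧ (∀ x < 4, s'.nat x = s.nat x) ∧ ∀ j < h, s'.fld 0 j =
      (mergeCurve ε r (seed ε Q i) (Nat.clog 2 n) j).eval (seed ε Q i (Nat.clog 2 n)))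
    n ?_ ?_ ?_ ?_) le_rfl ?_
  · rintro h hh s' ⟨h4', hn', hout⟩
    have hhZ : h.size ≤ Z := size_le_of_le hh.le hn
    have hhZ' : (h + 1).size ≤ Z := size_le_of_le hh hn
    refine ⟨?_, ?_, ?_⟩
    · simp [Test.holds, eval_reg, h4', hn', h0, hh]
    · simp [Test.cost, eval_reg, cost_reg, h4', hn', h0]
      omega
    · refine Runs.mono (Runs.setNat_seq (τ := 40 * (Z + 1)) ?_ <|
        Runs.setNat_seq (τ := 40 * (Z + 1)) ?_ <|
        runs_nextSeed (Z := Z) (i := i) (Q := Q)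
          (τ := (r + 1) * (200 * (Z + 1)) + (levelTime (Nat.clog 2 n) r Z +
            (40 * (Z + 1) + 40 * (Z + 1)))) ?_ ?_ hi hQ ?_) (by omega) (fun _ h => h)
      · simp [NatExpr.cost, NatExpr.eval, hn', h04, s4]
        omega
      · simp [NatExpr.cost, NatExpr.eval]
        omega
      · simp [State.writeNat, NatExpr.eval, hn', h04]
      · simp [State.writeNat, hn', h3]
      intro s₁ hn₁ h5₁ h7₁ hf₁ h2₁ h3₁
      have e6 : s₁.nat 6 0 = 1 := by
        rw [hn₁ 6 (by decide) (by decide)]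
        simp [State.writeNat, NatExpr.eval]
      have eold : ∀ x < 5, s₁.nat x = s'.nat x := by
        intro x hx
        have : x ≠ 5 ∧ x ≠ 6 ∧ x ≠ 7 := by omega
        simp [State.writeNat, this, hn₁]
      have e4 : s₁.nat 4 0 = h := by rw [eold 4 (by decide), h4']
      have e3 : s₁.nat 3 0 = Q := by rw [eold 3 (by decide), hn' 3 (by decide), h3]
      have e2 : s₁.nat 2 0 = r * r := by rw [eold 2 (by decide), hn' 2 (by decide), h2]
      have e1 : s₁.nat 1 0 = r := by rw [eold 1 (by decide), hn' 1 (by decide), h1]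
      have e0 : s₁.nat 0 0 = n := by rw [eold 0 (by decide), hn' 0 (by decide), h0]
      have es : ε (i % Q) = seed ε Q i 0 := by simp [seed]
      refine Runs.seq (runs_powerLoop (Z := Z) e1 e6 h7₁ h2₁ h3₁ (by omega) r1)
        fun s₂ ⟨hn₂, hf₂, hT₂⟩ => Runs.seq (runs_levelLoop (Z := Z) (n := n) (r := r) (Q := Q)
          (i := i) (j := h) ?_ ?_ ?_ ?_ ?_ ?_ ?_ ?_ (by omega) hn hR hQ hi hhZ hL hLr)
        fun s₃ ⟨hn₃, hf₃, h6₃, hT₃⟩ => Runs.setField_seq ?_ <| Runs.setNat ?_ ?_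
      · rw [hn₂ 0 (by decide), e0]
      · rw [hn₂ 1 (by decide), e1]
      · rw [hn₂ 2 (by decide), e2]
      · rw [hn₂ 3 (by decide), e3]
      · rw [hn₂ 4 (by decide), e4]
      · rw [hn₂ 5 (by decide), h5₁]
      · rw [hn₂ 6 (by decide), e6]
      · rw [← es]; exact hT₂
      all_goals
        have g4 : s₃.nat 4 0 = h := by rw [hn₃ 4 (by decide), hn₂ 4 (by decide), e4]
        have g1 : s₃.nat 1 0 = r := by rw [hn₃ 1 (by decide), hn₂ 1 (by decide), e1]
      · simp [FieldExpr.cost, NatExpr.cost, NatExpr.eval, eval_reg, cost_reg, g4, g1, h6₃]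
        omega
      · simp [State.writeField, NatExpr.cost, NatExpr.eval, eval_reg, cost_reg, g4]
        omega
      · refine ⟨?_, ?_, ?_⟩
        · simp [State.writeNat, State.writeField, NatExpr.eval, eval_reg, g4]
        · intro x hx
          have : x ≠ 4 ∧ x ≠ 7 := by omega
          simp [State.writeNat, State.writeField, this, hn₃ x (by omega), hn₂,
            eold x (by omega), hn' x hx]
        · intro j hj
          by_cases hjh : j = h
          · subst hjh
            -- The output is entry `0` of the last table, whose exponent is `0 + 1`.
            have := hT₃ 0 hr
            simp only [add_zero, zero_add, pow_one] at this
            rw [← this]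
            simp [State.writeNat, State.writeField, NatExpr.eval, FieldExpr.eval, eval_reg, g4, g1,
              h6₃]
          · rw [← hout j (by omega)]
            simp [State.writeNat, State.writeField, eval_reg, g4, hjh, hf₃, hf₂, hf₁]
  · rintro s' ⟨h4', hn', -⟩
    refine ⟨?_, ?_⟩
    · simp [Test.holds, eval_reg, h4', hn', h0]
    · simp [Test.cost, eval_reg, cost_reg, h4', hn', h0]
      omega
  · simp [h4]
  · omega
  · rintro s' ⟨-, -, h⟩
    exact h

theorem runs_hittingSetProg {n k e d i : ℕ} (hn0 : 1 ≤ n) (hk0 : 1 ≤ k) (he0 : 1 ≤ e)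
    (hd0 : 1 ≤ d) (hZ : 4 ≤ Z) (hQ : (8 * n * d ^ 2 * k ^ 4 * e ^ 6).size ≤ Z) (hi : i.size ≤ Z)
    (hL : (2 ^ Nat.clog 2 n * (k * e) + k * e).size ≤ Z) :
    Runs ε hittingSetProg (State.init [n, k, e, d, i])
      (300 * (Z + 1) + coordTime n (k * e) Z) fun s' => ∀ j < n, s'.fld 0 j =
      (mergeCurve ε (k * e) (seed ε (8 * n * d ^ 2 * k ^ 4 * e ^ 6) i) (Nat.clog 2 n) j).eval
        (seed ε (8 * n * d ^ 2 * k ^ 4 * e ^ 6) i (Nat.clog 2 n)) := by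
  set Q := 8 * n * d ^ 2 * k ^ 4 * e ^ 6 with hQdef
  have hr0 : 0 < k * e := Nat.mul_pos hk0 he0
  have hQ0 : 0 < Q := by positivity
  -- Every intermediate product in the computation of `Q` divides `Q`, so its bit length is at most
  -- that of `Q`.
  have hdvd : ∀ x y, x * y = Q → x.size ≤ Z := fun x y h =>
    size_le_of_le (Nat.le_of_dvd hQ0 ⟨y, h.symm⟩) hQ
  have b1 : n.size ≤ Z := hdvd _ (8 * d ^ 2 * k ^ 4 * e ^ 6) (by rw [hQdef]; ring)
  have b2 : k.size ≤ Z := hdvd _ (8 * n * d ^ 2 * k ^ 3 * e ^ 6) (by rw [hQdef]; ring)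
  have b3 : e.size ≤ Z := hdvd _ (8 * n * d ^ 2 * k ^ 4 * e ^ 5) (by rw [hQdef]; ring)
  have b4 : d.size ≤ Z := hdvd _ (8 * n * d * k ^ 4 * e ^ 6) (by rw [hQdef]; ring)
  have b5 : (k * e).size ≤ Z := hdvd _ (8 * n * d ^ 2 * k ^ 3 * e ^ 5) (by rw [hQdef]; ring)
  have b6 : (k * e * (k * e)).size ≤ Z :=
    hdvd _ (8 * n * d ^ 2 * k ^ 2 * e ^ 4) (by rw [hQdef]; ring)
  have b7 : (d * d).size ≤ Z := hdvd _ (8 * n * k ^ 4 * e ^ 6) (by rw [hQdef]; ring)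
  have b8 : (n * (d * d)).size ≤ Z := hdvd _ (8 * k ^ 4 * e ^ 6) (by rw [hQdef]; ring)
  have b9 : (8 * (n * (d * d))).size ≤ Z := hdvd _ (k ^ 4 * e ^ 6) (by rw [hQdef]; ring)
  have b10 : (k * e * (k * e) * (k * e * (k * e))).size ≤ Z :=
    hdvd _ (8 * n * d ^ 2 * e ^ 2) (by rw [hQdef]; ring)
  have b11 : (8 * (n * (d * d)) * (k * e * (k * e) * (k * e * (k * e)))).size ≤ Z :=
    hdvd _ (e ^ 2) (by rw [hQdef]; ring)
  have b12 : (8 * (n * (d * d)) * (k * e * (k * e) * (k * e * (k * e))) * e).size ≤ Z :=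
    hdvd _ e (by rw [hQdef]; ring)
  have hQe : 8 * (n * (d * d)) * (k * e * (k * e) * (k * e * (k * e))) * e * e = Q := by
    rw [hQdef]; ring
  have s1 : Nat.size 1 = 1 := by simp
  have s2 : Nat.size 2 = 2 := by decide
  have s3 : Nat.size 3 = 2 := by decide
  have s8 : Nat.size 8 = 4 := by decide
  refine Runs.mono (Runs.setNat_seq (τ := 40 * (Z + 1)) ?_ <|
    Runs.setNat_seq (τ := 40 * (Z + 1)) ?_ <|
    Runs.setNat_seq (τ := 160 * (Z + 1)) ?_ <|
    runs_coordLoop (Z := Z) (n := n) (r := k * e) (Q := Q) (i := i) ?_ ?_ ?_ ?_ ?_ ?_ hr0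
      (by omega) b1 b6 hQ hi ?_ hL) (by omega) (fun _ h => h)
  · simp [State.init, NatExpr.cost, NatExpr.eval, s2]
    omega
  · simp [State.init, State.writeNat, NatExpr.cost, NatExpr.eval, eval_reg, cost_reg]
    omega
  · simp [State.init, State.writeNat, NatExpr.cost, NatExpr.eval, eval_reg, cost_reg, s2, s3, s8,
      hQe]
    omega
  · simp [State.init, State.writeNat]
  · simp [State.init, State.writeNat]
  · simp [State.init, State.writeNat, NatExpr.eval]
  · simp [State.init, State.writeNat, NatExpr.eval, eval_reg]
  · rw [← hQe]
    simp [State.init, State.writeNat, NatExpr.eval, eval_reg]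
  · simp [State.init, State.writeNat]
  · exact size_le_of_le ((Nat.le_mul_of_pos_right _ hr0).trans (Nat.le_add_right _ _)) hL

end Correctness

/-- The exponent adds up as `14` for `Z`, `2 + 4 + 4` for the three nested loops of a merge, and `1`
each for levels and coordinates. -/
theorem coordTime_le {n r Z X : ℕ} (hX : 1 ≤ X) (hn : n + 1 ≤ X) (hr : r ≤ X ^ 2)
    (hZ : Z + 1 ≤ 9 * X ^ 14) :
    300 * (Z + 1) + coordTime n r Z ≤ 100000 * X ^ 26 := by
  have hp : ∀ {a b : ℕ}, a ≤ b → X ^ a ≤ X ^ b := fun h => Nat.pow_le_pow_right hX h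
  have hX2 : 1 ≤ X ^ 2 := Nat.one_le_pow _ _ hX
  have hr1 : r + 1 ≤ 2 * X ^ 2 := by omega
  have hrr : r * r + 1 ≤ 2 * X ^ 4 := by nlinarith
  have hL : Nat.clog 2 n + 1 ≤ X :=
    (Nat.succ_le_succ (Nat.clog_le_of_le_pow Nat.lt_two_pow_self.le)).trans hn
  have h1 : 400 * (Z + 1) + (r * r + 1) * (161 * (Z + 1)) ≤ 6498 * X ^ 18 := by
    calc _ ≤ 400 * (9 * X ^ 14) + (2 * X ^ 4) * (161 * (9 * X ^ 14)) := by gcongr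
      _ = 3600 * X ^ 14 + 2898 * X ^ 18 := by ring
      _ ≤ _ := by have := hp (show 14 ≤ 18 by norm_num); omega
  have h2 : mergeTime r Z ≤ 34992 * X ^ 24 := by
    calc _ ≤ 2 * X ^ 2 * (500 * (9 * X ^ 14) + 2 * X ^ 4 * (6498 * X ^ 18)) := by
          unfold mergeTime; gcongr
      _ = 9000 * X ^ 16 + 25992 * X ^ 24 := by ring
      _ ≤ _ := by have := hp (show 16 ≤ 24 by norm_num); omega
  have h3 : levelTime (Nat.clog 2 n) r Z ≤ 37692 * X ^ 25 := by
    calc _ ≤ X * (300 * (9 * X ^ 14) + 34992 * X ^ 24) := by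
          unfold levelTime; gcongr
      _ = 2700 * X ^ 15 + 34992 * X ^ 25 := by ring
      _ ≤ _ := by have := hp (show 15 ≤ 25 by norm_num); omega
  calc _ ≤ 300 * (9 * X ^ 14) + X * (500 * (9 * X ^ 14) + 2 * X ^ 2 * (200 * (9 * X ^ 14)) +
        37692 * X ^ 25) := by
        unfold coordTime; gcongr
    _ = 2700 * X ^ 14 + 4500 * X ^ 15 + 3600 * X ^ 17 + 37692 * X ^ 26 := by ring
    _ ≤ _ := by
      have := hp (show 14 ≤ 26 by norm_num)
      have := hp (show 15 ≤ 26 by norm_num)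
      have := hp (show 17 ≤ 26 by norm_num)
      omega

end AlgRAM

/-- The program finds the point with index `i` in polynomial time. -/
theorem AlgRAM.computes_hittingSetProg {F : Type*} [Field F] (ε : ℕ → F) {n k e d i : ℕ}
    (hn : 1 ≤ n) (hk : 1 ≤ k) (he : 1 ≤ e) (hd : 1 ≤ d)
    (hi : i < (8 * n * d ^ 2 * k ^ 4 * e ^ 6) ^ (Nat.clog 2 n + 1)) :
    Computes ε hittingSetProg [n, k, e, d, i]
      (fun j : Fin n => (mergeCurve ε (k * e) (seed ε (8 * n * d ^ 2 * k ^ 4 * e ^ 6) i)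
        (Nat.clog 2 n) j).eval (seed ε (8 * n * d ^ 2 * k ^ 4 * e ^ 6) i (Nat.clog 2 n)))
      (100 * (n + k + e + d + 1) ^ 100) := by
  -- From `Q < 2 ^ Q` and `i < Q ^ (⌈lg n⌉ + 1)` one gets `i < 2 ^ ((n + 1) * Q)`; this crude `Z` is
  -- still polynomial.
  have key := fun hZ => runs_hittingSetProg (ε := ε) (Z := (n + 1) *
    (8 * n * d ^ 2 * k ^ 4 * e ^ 6)) (i := i) hn hk he hd hZ
  obtain ⟨Q, hQ⟩ : ∃ Q, Q = 8 * n * d ^ 2 * k ^ 4 * e ^ 6 := ⟨_, rfl⟩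
  obtain ⟨X, hX⟩ : ∃ X, X = n + k + e + d + 1 := ⟨_, rfl⟩
  rw [← hQ] at hi key
  rw [← hQ, ← hX]
  have hclog : Nat.clog 2 n ≤ n := Nat.clog_le_of_le_pow Nat.lt_two_pow_self.le
  have hke : 0 < k * e := Nat.mul_pos hk he
  have hrQ : 2 * (k * e) ≤ Q := by
    have : 0 < n * d ^ 2 * k ^ 3 * e ^ 5 := by positivity
    calc 2 * (k * e) ≤ 8 * (k * e) := by omega
      _ ≤ 8 * (k * e) * (n * d ^ 2 * k ^ 3 * e ^ 5) := Nat.le_mul_of_pos_right _ this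
      _ = Q := by rw [hQ]; ring
  have hQ8 : 8 ≤ Q := by
    have : 0 < n * d ^ 2 * k ^ 4 * e ^ 6 := by positivity
    calc 8 ≤ 8 * (n * d ^ 2 * k ^ 4 * e ^ 6) := Nat.le_mul_of_pos_right _ this
      _ = Q := by rw [hQ]; ring
  have hZ : 4 ≤ (n + 1) * Q := by nlinarith
  have hQX : Q ≤ 8 * X ^ 13 := by
    calc Q ≤ 8 * X * X ^ 2 * X ^ 4 * X ^ 6 := by rw [hQ]; gcongr <;> omega
      _ = 8 * X ^ 13 := by ring
  have hZX : (n + 1) * Q + 1 ≤ 9 * X ^ 14 := by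
    have : 1 ≤ X ^ 14 := Nat.one_le_pow _ _ (by omega)
    calc (n + 1) * Q + 1 ≤ X * (8 * X ^ 13) + X ^ 14 := by gcongr; omega
      _ = 9 * X ^ 14 := by ring
  have z1 : Q < 2 ^ ((n + 1) * Q) :=
    lt_of_lt_of_le Nat.lt_two_pow_self (Nat.pow_le_pow_right (by norm_num)
      (Nat.le_mul_of_pos_left _ (by omega)))
  have z2 : i < 2 ^ ((n + 1) * Q) := by
    calc i < Q ^ (Nat.clog 2 n + 1) := hi
      _ ≤ (2 ^ Q) ^ (n + 1) :=
        (Nat.pow_le_pow_left Nat.lt_two_pow_self.le _).trans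
          (Nat.pow_le_pow_right (by positivity) (by omega))
      _ = 2 ^ ((n + 1) * Q) := by rw [← pow_mul, mul_comm]
  have z3 : 2 ^ Nat.clog 2 n * (k * e) + k * e < 2 ^ ((n + 1) * Q) := by
    calc 2 ^ Nat.clog 2 n * (k * e) + k * e ≤ 2 ^ n * (k * e) + 2 ^ n * (k * e) :=
          add_le_add (Nat.mul_le_mul_right _ (Nat.pow_le_pow_right (by norm_num) hclog))
            (Nat.le_mul_of_pos_left _ (by positivity))
      _ = 2 ^ n * (2 * (k * e)) := by ring
      _ < 2 ^ n * 2 ^ Q := by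
        gcongr
        exact hrQ.trans_lt Nat.lt_two_pow_self
      _ ≤ 2 ^ ((n + 1) * Q) := by
        rw [← pow_add]
        exact Nat.pow_le_pow_right (by norm_num) (by nlinarith)
  obtain ⟨t, ht, s', hs, h⟩ := key hZ (Nat.size_le.2 z1) (Nat.size_le.2 z2) (Nat.size_le.2 z3)
  refine ⟨t, ht.trans ((coordTime_le (X := X) (by omega) (by omega) ?_ hZX).trans ?_), s', hs,
    fun j => h j j.isLt⟩
  · rw [pow_two]
    exact Nat.mul_le_mul (by omega) (by omega)
  -- All four parameters are positive, so `X ≥ 5`, and `5 ^ 8` exceeds `100000`.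
  · calc 100000 * X ^ 26 ≤ X ^ 8 * X ^ 26 := by
          gcongr
          exact le_trans (by norm_num) (Nat.pow_le_pow_left (show 5 ≤ X by omega) 8)
      _ = X ^ 34 := by ring
      _ ≤ X ^ 100 := Nat.pow_le_pow_right (by omega) (by norm_num)
      _ ≤ 100 * X ^ 100 := Nat.le_mul_of_pos_left _ (by norm_num)

/-! ### Degenerate parameters and the main theorem. -/

theorem eq_zero_of_mem_semiDiagonalClass {F : Type*} [Field F] {n k e d : ℕ}
    (h : k = 0 ∨ e = 0) {f : MvPolynomial (Fin n) F} (hf : f ∈ semiDiagonalClass F n k e d) :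
    f = 0 := by
  obtain ⟨Φ, -, he, -, rfl⟩ := hf
  rcases Nat.eq_zero_or_pos k with rfl | hk
  · simp [SemiDiagonalCircuit.toPoly]
  · have h1 := he ⟨0, hk⟩
    have h2 : 0 < ∏ j, (1 + Φ.expo ⟨0, hk⟩ j) := Finset.prod_pos fun _ _ => by omega
    omega

theorem mainTheorem7 :
    ∃ (p : AlgRAM.Prog) (c : ℕ),
      ∀ (F : Type*) [Field F] (ε : ℕ → F), IsEnumeration ε →
      ∀ n k e d : ℕ, 1 ≤ n → 1 ≤ d →
        (((4 * n * d * k ^ 3 * e ^ 4) ^ 2 : ℕ) : ℕ∞) ≤ ENat.card F →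
        ∃ H : Finset (Fin n → F),
          H.card ≤ (8 * n * d ^ 2 * k ^ 4 * e ^ 6) ^ (Nat.clog 2 n + 1) ∧
          IsHittingSet (semiDiagonalClass F n k e d) (H : Set (Fin n → F)) ∧
          IsExplicit ε p [n, k, e, d]
            ((8 * n * d ^ 2 * k ^ 4 * e ^ 6) ^ (Nat.clog 2 n + 1))
            (c * (n + k + e + d + 1) ^ c) (H : Set (Fin n → F)) := by
  classical
  refine ⟨AlgRAM.hittingSetProg, 100, fun F _ ε hε n k e d hn hd hF => ?_⟩
  by_cases hke : k = 0 ∨ e = 0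
  -- The bound is `0` here, so the hitting set must be empty; this works because the class contains
  -- no nonzero polynomial.
  · have hN : (8 * n * d ^ 2 * k ^ 4 * e ^ 6) ^ (Nat.clog 2 n + 1) = 0 := by
      rcases hke with rfl | rfl <;> simp
    rw [hN]
    refine ⟨∅, le_rfl, fun f hf => ?_, Fin.elim0, ?_, fun i => i.elim0⟩
    · simp [eq_zero_of_mem_semiDiagonalClass hke hf]
    · simp
  push Not at hke
  have hk : 1 ≤ k := Nat.pos_of_ne_zero hke.1
  have he : 1 ≤ e := Nat.pos_of_ne_zero hke.2
  set Q := 8 * n * d ^ 2 * k ^ 4 * e ^ 6 with hQ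
  let pt : Fin (Q ^ (Nat.clog 2 n + 1)) → Fin n → F := fun i j =>
    (mergeCurve ε (k * e) (seed ε Q i) (Nat.clog 2 n) j).eval (seed ε Q i (Nat.clog 2 n))
  refine ⟨Finset.univ.image pt, ?_, fun f hf => ⟨?_, fun h => ?_⟩, pt, by simp, fun i =>
    AlgRAM.computes_hittingSetProg ε hn hk he hd i.isLt⟩
  · exact Finset.card_image_le.trans (by simp)
  · rintro rfl
    simp
  · by_contra hf0
    -- `A` bounds the bad elements at each level, so `A + 1` enumerated elements suffice; these fit
    -- into both `F` and one base `Q` digit.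
    set A := n * d * k ^ 4 * e ^ 5 with hA
    have hA0 : 0 < A := by positivity
    have hT1 : A + 1 ≤ (4 * n * d * k ^ 3 * e ^ 4) ^ 2 := by
      have : 0 < n * d * k ^ 2 * e ^ 3 := by positivity
      calc A + 1 ≤ 16 * A := by omega
        _ ≤ 16 * A * (n * d * k ^ 2 * e ^ 3) := Nat.le_mul_of_pos_right _ this
        _ = _ := by rw [hA]; ring
    have hT2 : A + 1 ≤ Q := by
      have : 0 < d * e := by positivity
      calc A + 1 ≤ 8 * A := by omega
        _ ≤ 8 * A * (d * e) := Nat.le_mul_of_pos_right _ this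
        _ = Q := by rw [hA, hQ]; ring
    have hrr : k * e * (k * e) ≤ A + 1 := by
      have : 0 < n * d * k ^ 2 * e ^ 3 := by positivity
      calc k * e * (k * e) ≤ k * e * (k * e) * (n * d * k ^ 2 * e ^ 3) :=
            Nat.le_mul_of_pos_right _ this
        _ = A := by rw [hA]; ring
        _ ≤ A + 1 := Nat.le_succ _
    obtain ⟨i, hi, hne⟩ := exists_seed_eval_mergeCurve_ne_zero hf hf0 hε hn hk he
      (T := A + 1) (Q := Q) (le_trans (by exact_mod_cast hT1) hF)
      (Nat.lt_succ_of_le (le_of_eq (by rw [hA]; ring))) hrr hT2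
    exact hne (h (pt ⟨i, hi⟩) (by simp))
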